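/- Let $d\ge 1$, $0<\alpha\le 1$ and $\lambda>0$. Let $-\Delta$ be the discrete Laplacian on $\ell^2(\mathbb Z^d)$, $(-\Delta\varphi)(n)=\sum_{|m-n|_1=1}(\varphi(n)-\varphi(m))$, and let $(-\Delta)^\alpha$ be defined by the functional calculus. Let $P_0$ be a Borel probability measure on $\mathbb R$ that is not concentrated at a single point and satisfies $\inf\operatorname{supp}P_0=0$ (the support may be unbounded above). Let $\omega=(\omega_n)_{n\in\mathbb Z^d}$ be distributed according to the product measure $\mathbb P=\bigotimes_{\mathbb Z^d}P_0$, with expectation $\mathbb E$; let $V_\omega$ be the operator of multiplication by $\omega$ on its maximal domain, and let $H_\alpha=(-\Delta)^\alpha+\lambda V_\omega$. Let $$N_\alpha(E)=\mathbb E\big[\langle\delta_0,1_{(-\infty,E]}(H_\alpha)\,\delta_0\rangle\big],\qquad E\in\mathbb R,$$ be the integrated density of states of $H_\alpha$, where $1_{(-\infty,E]}(H_\alpha)$ is the spectral projection and $\delta_0$ is the canonical basis vector at the origin. Then $$\limsup_{E\searrow 0}\frac{\ln|\ln N_\alpha(E)|}{\ln E}\le-\frac{d}{2\alpha}.$$ If,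 in addition, there are constants $C,\kappa>0$ such that $P_0([0,\varepsilon))\ge C\varepsilon^\kappa$ for all sufficiently small $\varepsilon>0$, then the limit exists and $$\lim_{E\searrow 0}\frac{\ln|\ln N_\alpha(E)|}{\ln E}=-\frac{d}{2\alpha}.$$ -/

import Mathlib

open Filter Topology MeasureTheory
open scoped ENNReal

noncomputable section

namespace FractionalAnderson

/-! ### Spectral projections of (possibly unbounded) self-adjoint operators -/

section Spectral

variable {𝓗 : Type*} [NormedAddCommGroup 𝓗] [InnerProductSpace ℂ 𝓗] [CompleteSpace 𝓗]

/-- The bounded operator `R` is the resolvent `(T - z)⁻¹` of the (partially defined) operator `T`: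
it maps into the domain of `T` and is a two-sided inverse of `T - z`. -/
def IsResolventAt (T : 𝓗 →ₗ.[ℂ] 𝓗) (z : ℂ) (R : 𝓗 →L[ℂ] 𝓗) : Prop :=
  (∀ x : 𝓗, ∃ h : R x ∈ T.domain, T ⟨R x, h⟩ - z • R x = x) ∧
    ∀ y : T.domain, R (T y - z • (y : 𝓗)) = y

open Classical in
/-- The resolvent `(T - z)⁻¹` (and `0` if `z` is not in the resolvent set of `T`). -/
def resolventAt (T : 𝓗 →ₗ.[ℂ] 𝓗) (z : ℂ) : 𝓗 →L[ℂ] 𝓗 :=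
  if h : ∃ R : 𝓗 →L[ℂ] 𝓗, IsResolventAt T z R then h.choose else 0

/-- The bounded self-adjoint operator `(T - E) ((T - E)² + 1)⁻¹`, for self-adjoint `T`: the real
part of `(T - E - i)⁻¹`.  It is a function of `T` that has the sign of `T - E`. -/
def signedResolvent (T : 𝓗 →ₗ.[ℂ] 𝓗) (E : ℝ) : 𝓗 →L[ℂ] 𝓗 :=
  ((realPart (resolventAt T ((E : ℂ) + Complex.I)) : selfAdjoint (𝓗 →L[ℂ] 𝓗)) : 𝓗 →L[ℂ] 𝓗)

/-- The spectral projection `1_{(-∞, E]}(T)` of a self-adjoint operator `T`.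
With `g x = (x - E) / ((x - E) ^ 2 + 1)`, one has `x ≤ E` iff the positive part `(g x)⁺` vanishes,
so `1_{(-∞, E]}(T)` is the orthogonal projection onto the kernel of `(g(T))⁺`
(positive part in the sense of the functional calculus). -/
def spectralProjection (T : 𝓗 →ₗ.[ℂ] 𝓗) (E : ℝ) : 𝓗 →L[ℂ] 𝓗 :=
  ((signedResolvent T E)⁺).ker.starProjection

/-- The power `A ^ α` of a nonnegative bounded operator, by the continuous functional calculus. -/
def fracPow (A : 𝓗 →L[ℂ] 𝓗) (α : ℝ) : 𝓗 →L[ℂ] 𝓗 := A ^ α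

end Spectral

/-! ### The fractional Anderson model -/

/-- The lattice `ℤ^d`. -/
abbrev Lattice (d : ℕ) : Type := Fin d → ℤ

/-- The Hilbert space `ℓ²(ℤ^d)` of complex-valued square-summable functions. -/
abbrev L2 (d : ℕ) : Type := lp (fun _ : Lattice d => ℂ) 2

/-- The canonical basis vector `δ_n`. -/
def delta {d : ℕ} (n : Lattice d) : L2 d := lp.single 2 n (1 : ℂ)

theorem memℓp_comp_add {d : ℕ} (φ : L2 d) (v : Lattice d) :
    Memℓp (fun n : Lattice d => (φ : Lattice d → ℂ) (n + v)) 2 := by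
  have h := lp.memℓp φ
  rw [memℓp_gen_iff (by norm_num)] at h ⊢
  exact (Equiv.addRight v).summable_iff.mpr h

/-- The translation `(τ_v φ)(n) = φ (n + v)` on `ℓ²(ℤ^d)`. -/
def translation {d : ℕ} (v : Lattice d) : L2 d →L[ℂ] L2 d :=
  LinearMap.mkContinuous
    { toFun := fun φ => ⟨fun n => (φ : Lattice d → ℂ) (n + v), memℓp_comp_add φ v⟩
      map_add' := fun _ _ => rfl
      map_smul' := fun _ _ => rfl } 1 (by
    intro φ
    rw [one_mul, lp.norm_eq_tsum_rpow (by norm_num), lp.norm_eq_tsum_rpow (by norm_num)]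
    exact le_of_eq (congrArg (· ^ (1 / (2 : ℝ≥0∞).toReal))
      ((Equiv.addRight v).tsum_eq
        (fun n => ‖(φ : Lattice d → ℂ) n‖ ^ (2 : ℝ≥0∞).toReal))))

/-- The negative discrete Laplacian `-Δ` on `ℓ²(ℤ^d)`; see `negLaplacian_apply`. -/
def negLaplacian (d : ℕ) : L2 d →L[ℂ] L2 d :=
  ∑ j : Fin d, ((1 - translation (Pi.single j 1)) + (1 - translation (-Pi.single j 1)))

/-- The nearest neighbours of a lattice point are its translates by the `±` unit vectors. -/
theorem range_neighbour {d : ℕ} (n : Lattice d) :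
    Set.range (fun p : Fin d × Bool => n + (if p.2 then Pi.single p.1 1 else -Pi.single p.1 1)) =
      {m : Lattice d | ∑ j, |n j - m j| = 1} := by
  ext m
  simp only [Set.mem_range, Set.mem_ofPred_eq, Prod.exists]
  constructor
  · rintro ⟨j, b, rfl⟩
    rw [Finset.sum_eq_single j]
    · cases b <;> simp
    · intro i _ hi
      cases b <;> simp [hi]
    · simp
  · intro h
    have hex : ∃ j, n j - m j ≠ 0 := by
      by_contra hcon
      push Not at hcon
      simp [hcon] at h
    obtain ⟨j, hj⟩ := hex
    have h1 : 1 ≤ |n j - m j| := Int.one_le_abs hj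
    rw [← Finset.add_sum_erase _ _ (Finset.mem_univ j)] at h
    have h2 : 0 ≤ ∑ i ∈ Finset.univ.erase j, |n i - m i| :=
      Finset.sum_nonneg fun _ _ => abs_nonneg _
    have h3 : ∑ i ∈ Finset.univ.erase j, |n i - m i| = 0 := by omega
    have h4 : |n j - m j| = 1 := by omega
    rw [Finset.sum_eq_zero_iff_of_nonneg fun _ _ => abs_nonneg _] at h3
    have h5 : ∀ i, i ≠ j → n i = m i := fun i hi => by
      have := h3 i (Finset.mem_erase.mpr ⟨hi, Finset.mem_univ i⟩)
      rw [abs_eq_zero] at this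
      omega
    rcases (abs_eq (by norm_num : (0 : ℤ) ≤ 1)).mp h4 with h6 | h6
    · refine ⟨j, false, funext fun i => ?_⟩
      by_cases hi : i = j
      · subst hi
        simp
        omega
      · simp [hi, h5 i hi]
    · refine ⟨j, true, funext fun i => ?_⟩
      by_cases hi : i = j
      · subst hi
        simp
        omega
      · simp [hi, h5 i hi]

theorem neighbour_injective {d : ℕ} (n : Lattice d) :
    Function.Injective (fun p : Fin d × Bool =>
      n + (if p.2 then Pi.single p.1 1 else -Pi.single p.1 1)) := by
  rintro ⟨j, b⟩ ⟨k, c⟩ h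
  have h1 := congrFun h j
  by_cases hjk : j = k
  · subst hjk
    cases b <;> cases c <;> simp at h1 ⊢
  · cases b <;> cases c <;> simp [hjk] at h1

/-- `(-Δ φ)(n)` is the sum of `φ n - φ m` over the `m` at `ℓ¹`-distance `1` from `n`. -/
theorem negLaplacian_apply {d : ℕ} (φ : L2 d) (n : Lattice d) :
    (negLaplacian d φ : Lattice d → ℂ) n =
      ∑ᶠ m ∈ {m : Lattice d | ∑ j, |n j - m j| = 1},
        ((φ : Lattice d → ℂ) n - (φ : Lattice d → ℂ) m) := by
  rw [← range_neighbour n, finsum_mem_range (neighbour_injective n), finsum_eq_sum_of_fintype,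
    Fintype.sum_prod_type, negLaplacian, sum_apply, lp.coeFn_sum,
    Finset.sum_apply]
  refine Finset.sum_congr rfl fun j _ => ?_
  rw [Fintype.sum_bool]
  rfl

/-- The fractional Laplacian `(-Δ)^α`, by the continuous functional calculus. -/
def fracLaplacian (d : ℕ) (α : ℝ) : L2 d →L[ℂ] L2 d := 
  fracPow (negLaplacian d) α

/-- The potential `V_ω = ∑ₙ ω n |δₙ⟩⟨δₙ|`, i.e. the operator of multiplication by `ω` on its
maximal domain `{φ ∈ ℓ²(ℤ^d) | ω φ ∈ ℓ²(ℤ^d)}`. -/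
def potential {d : ℕ} (ω : Lattice d → ℝ) : L2 d →ₗ.[ℂ] L2 d where
  domain :=
    { carrier := {φ | Memℓp (fun n => (ω n : ℂ) * (φ : Lattice d → ℂ) n) 2}
      add_mem' := fun {φ ψ} hφ hψ => by
        have h : (fun n => (ω n : ℂ) * ((φ + ψ : L2 d) : Lattice d → ℂ) n) =
            (fun n => (ω n : ℂ) * (φ : Lattice d → ℂ) n) +
              fun n => (ω n : ℂ) * (ψ : Lattice d → ℂ) n :=
          funext fun n => mul_add _ _ _
        rw [Set.mem_ofPred_eq, h]
        exact Memℓp.add hφ hψ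
      zero_mem' := by
        have h : (fun n => (ω n : ℂ) * ((0 : L2 d) : Lattice d → ℂ) n) = 0 :=
          funext fun n => mul_zero _
        rw [Set.mem_ofPred_eq, h]
        exact zero_memℓp
      smul_mem' := fun c φ hφ => by
        have h : (fun n => (ω n : ℂ) * ((c • φ : L2 d) : Lattice d → ℂ) n) =
            c • fun n => (ω n : ℂ) * (φ : Lattice d → ℂ) n :=
          funext fun n => mul_left_comm _ _ _
        rw [Set.mem_ofPred_eq, h]
        exact Memℓp.const_smul hφ c }
  toFun :=
    { toFun := fun φ => ⟨fun n => (ω n : ℂ) * ((φ : L2 d) : Lattice d → ℂ) n, φ.2⟩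
      map_add' := fun φ ψ => by
        ext n
        exact mul_add _ _ _
      map_smul' := fun c φ => by
        ext n
        exact mul_left_comm _ _ _ }

/-- The fractional Anderson Hamiltonian `H_α = (-Δ)^α + lam • V_ω`, on the domain of `V_ω`. -/
def hamiltonian {d : ℕ} (α lam : ℝ) (ω : Lattice d → ℝ) : L2 d →ₗ.[ℂ] L2 d :=
  (fracLaplacian d α : L2 d →ₗ[ℂ] L2 d) +ᵥ ((lam : ℂ) • potential ω)

/-- The integrated density of states `N_α(E) = 𝔼 ⟨δ₀, 1_{(-∞, E]}(H_α) δ₀⟩`, the expectation being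
with respect to the product measure `⨂_{ℤ^d} P₀` on `ℝ^{ℤ^d}`. -/
def ids (d : ℕ) (α lam : ℝ) (P₀ : Measure ℝ) [IsProbabilityMeasure P₀] (E : ℝ) : ℝ :=
  ∫ ω : Lattice d → ℝ,
    (inner ℂ (delta 0) (spectralProjection (hamiltonian α lam ω) E (delta 0))).re
    ∂(Measure.infinitePi fun _ : Lattice d => P₀)

end FractionalAnderson

end

/-!
Write `Q` for the spectral projection of `H = (-Δ)^α + lam V` onto energies at most `E`, so that
the integrated density of states is the expectation of `‖Q δ₀‖²`. Both bounds work directly with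
`Q` on the infinite lattice, without restricting `H` to boxes. They rest on two properties of `Q`:
on its range the form of `H` is at most `E` (`IsSelfAdjointOp.apply_spectralProjection_le`), and
`E ‖φ - Q φ‖² ≤ ⟪φ, H φ⟫` for `φ` in the domain
(`IsSelfAdjointOp.mul_norm_sub_spectralProjection_sq_le`).

*Upper bound.* By the Löwner-Heinz inequality the form of `(-Δ)^α` dominates finite differences over
distances up to `L`, up to a factor of order `L ^ (2 α)`
(`norm_sub_translation_sq_le_fracLaplacian`). Call a site typical if `V ≥ c` on a portion `θ` of the
sites of the box of size `L` around it. The mass of `φ` at a typical site is bounded by the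
potential energy of `φ` around this site plus differences of `φ`, so that the total mass of `φ` at
the typical sites is at most `K L ^ (2 α) ⟪φ, H φ⟫ / θ` (`sum_norm_sq_le_re_inner_hamiltonian`). For
`L` a small multiple of `E ^ (-1 / (2 α))`, functions in the range of `Q` thus have at least half of
their mass at atypical sites. Translation covariance turns this into
`N(E) ≤ 2 ℙ(the origin is atypical)` by mass transport (`lintegral_tsum_indicator_shift`), and a
Chernoff bound (`exists_measure_countLarge_le`) makes this probability exponentially small in
`L ^ d ∼ E ^ (-d / (2 α))`.

*Lower bound.* A pyramid over a box of size `M` has energy at most `M ^ (-2)`, up to a constant,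
with respect to `-Δ`, hence at most `M ^ (-2 α)`, up to a constant, with respect to `(-Δ)^α` by
concavity (`re_inner_fracPow_le`). If `V ≤ E / (4 lam)` on the box and `M` is a large multiple of
`E ^ (-1 / (2 α))`, the pyramid has energy at most `E / 2`, so half of its mass lies in the range of
`Q`, and `∑ ‖Q δ_n‖² ≥ 1 / 2` over the box (`half_le_sum_norm_spectralProjection_sq`). By
independence the event has probability `P₀([0, E / (4 lam)))` to the power of the volume of the box,
whose logarithm is of order `E ^ (-d / (2 α)) ln E` under the assumption on `P₀` near `0`; the
factor `ln E` disappears in the double logarithm.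

*Measurability.* The resolvent of `H` is strongly continuous in `ω`
(`continuous_resolventAt_hamiltonian`), hence so is the positive part of the signed resolvent, and
the projection onto the kernel of the latter is a strong limit of continuous functions by the mean
ergodic theorem (`measurable_inner_starProjection_ker_posPart`).
-/

noncomputable section

namespace FractionalAnderson

/-! ### Self-adjoint operators: resolvents and bounds on the spectral projections -/

section AbstractSpectral

variable {𝓗 : Type*} [NormedAddCommGroup 𝓗] [InnerProductSpace ℂ 𝓗] [CompleteSpace 𝓗]

/-- A self-adjoint partially defined operator, in the form in which self-adjointness is used here:
it is symmetric and every non-real number lies in its resolvent set. -/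
structure IsSelfAdjointOp (T : 𝓗 →ₗ.[ℂ] 𝓗) : Prop where
  symm : T.IsFormalAdjoint T
  exists_resolvent : ∀ z : ℂ, z.im ≠ 0 → ∃ R : 𝓗 →L[ℂ] 𝓗, IsResolventAt T z R

omit [CompleteSpace 𝓗] in
theorem IsResolventAt.unique {T : 𝓗 →ₗ.[ℂ] 𝓗} {z : ℂ} {R R' : 𝓗 →L[ℂ] 𝓗}
    (h : IsResolventAt T z R) (h' : IsResolventAt T z R') : R = R' := by
  ext x
  obtain ⟨hd, hx⟩ := h.1 x
  have := h'.2 ⟨R x, hd⟩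
  rw [hx] at this
  exact this.symm

omit [CompleteSpace 𝓗] in
theorem IsResolventAt.resolventAt_eq {T : 𝓗 →ₗ.[ℂ] 𝓗} {z : ℂ} {R : 𝓗 →L[ℂ] 𝓗}
    (h : IsResolventAt T z R) : resolventAt T z = R := by
  have hex : ∃ R : 𝓗 →L[ℂ] 𝓗, IsResolventAt T z R := ⟨R, h⟩
  rw [resolventAt, dif_pos hex]
  exact hex.choose_spec.unique h

omit [CompleteSpace 𝓗] in
/-- The basic criterion of self-adjointness: `⟪φ, T φ⟫` is real, so a non-real `z` cannot be an
approximate eigenvalue. -/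
theorem abs_im_mul_norm_le {T : 𝓗 →ₗ.[ℂ] 𝓗} (hT : T.IsFormalAdjoint T) (z : ℂ) (φ : T.domain) :
    |z.im| * ‖(φ : 𝓗)‖ ≤ ‖T φ - z • (φ : 𝓗)‖ := by
  have him : (inner ℂ (φ : 𝓗) (T φ)).im = 0 := by
    have h := inner_conj_symm (𝕜 := ℂ) (φ : 𝓗) (T φ)
    rw [hT φ φ] at h
    exact Complex.conj_eq_iff_im.mp h
  have h2 : (inner ℂ (φ : 𝓗) (T φ - z • (φ : 𝓗))).im = -(z.im * ‖(φ : 𝓗)‖ ^ 2) := by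
    rw [inner_sub_right, inner_smul_right, Complex.sub_im, him, inner_self_eq_norm_sq_to_K,
      RCLike.ofReal_eq_complex_ofReal, ← Complex.ofReal_pow, Complex.im_mul_ofReal, zero_sub]
  have h3 : |z.im| * ‖(φ : 𝓗)‖ ^ 2 ≤ ‖(φ : 𝓗)‖ * ‖T φ - z • (φ : 𝓗)‖ := by
    calc |z.im| * ‖(φ : 𝓗)‖ ^ 2 = |(inner ℂ (φ : 𝓗) (T φ - z • (φ : 𝓗))).im| := by
          rw [h2, abs_neg, abs_mul, abs_of_nonneg (sq_nonneg ‖(φ : 𝓗)‖)]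
      _ ≤ ‖inner ℂ (φ : 𝓗) (T φ - z • (φ : 𝓗))‖ := Complex.abs_im_le_norm _
      _ ≤ _ := norm_inner_le_norm _ _
  by_cases hy0 : ‖(φ : 𝓗)‖ = 0
  · rw [hy0]; simp
  · have hpos : 0 < ‖(φ : 𝓗)‖ := lt_of_le_of_ne (norm_nonneg _) (Ne.symm hy0)
    nlinarith

omit [CompleteSpace 𝓗] in
/-- A symmetric operator `T` with `T - z` surjective, `z` non-real, has a resolvent at `z`. -/
theorem exists_isResolventAt {T : 𝓗 →ₗ.[ℂ] 𝓗} (hT : T.IsFormalAdjoint T) {z : ℂ} (hz : z.im ≠ 0)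
    (hsurj : ∀ x : 𝓗, ∃ φ : T.domain, T φ - z • (φ : 𝓗) = x) :
    ∃ R : 𝓗 →L[ℂ] 𝓗, IsResolventAt T z R := by
  let f : T.domain →ₗ[ℂ] 𝓗 := T.toFun - z • T.domain.subtype
  have hf : ∀ φ : T.domain, f φ = T φ - z • (φ : 𝓗) := fun φ => rfl
  have hinj : Function.Injective f := by
    rw [injective_iff_map_eq_zero]
    intro φ hφ
    have h := abs_im_mul_norm_le hT z φ
    rw [← hf, hφ, norm_zero] at h
    have h2 : ‖(φ : 𝓗)‖ ≤ 0 := by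
      by_contra hcon
      push Not at hcon
      exact absurd h (not_le.mpr (mul_pos (abs_pos.mpr hz) hcon))
    exact Subtype.ext (norm_le_zero_iff.mp h2)
  let e := LinearEquiv.ofBijective f ⟨hinj, hsurj⟩
  have he : ∀ x, f (e.symm x) = x := fun x => e.apply_symm_apply x
  refine ⟨(T.domain.subtype ∘ₗ e.symm.toLinearMap).mkContinuous |z.im|⁻¹ fun x => ?_,
    fun x => ⟨(e.symm x).2, he x⟩, fun φ => ?_⟩
  · have h := abs_im_mul_norm_le hT z (e.symm x)
    rw [← hf, he] at h
    rwa [inv_mul_eq_div, le_div_iff₀' (abs_pos.mpr hz)]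
  · change ((e.symm (f φ) : T.domain) : 𝓗) = φ
    exact congrArg _ (e.symm_apply_apply φ)

theorem im_add_I_ne (E : ℝ) : ((E : ℂ) + Complex.I).im ≠ 0 := by simp

theorem isSelfAdjoint_signedResolvent (T : 𝓗 →ₗ.[ℂ] 𝓗) (E : ℝ) :
    IsSelfAdjoint (signedResolvent T E) := Subtype.prop _

omit [CompleteSpace 𝓗] in
theorem re_inner_nonneg {A : 𝓗 →L[ℂ] 𝓗} (hA : 0 ≤ A) (x : 𝓗) :
    0 ≤ (inner ℂ x (A x)).re :=
  ((ContinuousLinearMap.nonneg_iff_isPositive A).mp hA).re_inner_nonneg_right x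

theorem re_inner_signedResolvent_nonpos {E : ℝ} {x : 𝓗}
    (hx : x ∈ ((signedResolvent T E)⁺).ker) : (inner ℂ x (signedResolvent T E x)).re ≤ 0 := by
  have hx' : (signedResolvent T E)⁺ x = 0 := hx
  have hS := congrArg (fun A : 𝓗 →L[ℂ] 𝓗 => A x)
    (CFC.posPart_sub_negPart _ (isSelfAdjoint_signedResolvent T E))
  simp only [sub_apply, hx', zero_sub] at hS
  rw [← hS, inner_neg_right, Complex.neg_re]
  exact neg_nonpos.mpr (re_inner_nonneg (CFC.negPart_nonneg (signedResolvent T E)) x)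

/-- The negative part `S⁻` maps into the kernel of `S⁺`, so it vanishes on the orthogonal complement
of this kernel. -/
theorem re_inner_signedResolvent_nonneg {E : ℝ} {x : 𝓗}
    (hx : x ∈ ((signedResolvent T E)⁺).kerᗮ) : 0 ≤ (inner ℂ x (signedResolvent T E x)).re := by
  let S := signedResolvent T E
  have hs : ContinuousLinearMap.adjoint S⁻ = S⁻ :=
    IsSelfAdjoint.of_nonneg (CFC.negPart_nonneg S)
  have hmem : ∀ y, S⁻ y ∈ S⁺.ker := fun y =>
    congrArg (fun A : 𝓗 →L[ℂ] 𝓗 => A y) (CFC.posPart_mul_negPart S)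
  have h : S⁻ x = 0 := by
    rw [← inner_self_eq_zero (𝕜 := ℂ)]
    nth_rewrite 1 [← hs]
    rw [ContinuousLinearMap.adjoint_inner_left, ← inner_conj_symm,
      (Submodule.mem_orthogonal _ _).mp hx _ (hmem _), map_zero]
  have hS := congrArg (fun A : 𝓗 →L[ℂ] 𝓗 => A x)
    (CFC.posPart_sub_negPart S (isSelfAdjoint_signedResolvent T E))
  simp only [sub_apply, h, sub_zero] at hS
  rw [← hS]
  exact re_inner_nonneg (CFC.posPart_nonneg S) x

namespace IsSelfAdjointOp

variable {T : 𝓗 →ₗ.[ℂ] 𝓗} (hT : IsSelfAdjointOp T)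
include hT

omit [CompleteSpace 𝓗] in
theorem isResolventAt {z : ℂ} (hz : z.im ≠ 0) : IsResolventAt T z (resolventAt T z) := by
  obtain ⟨R, hR⟩ := hT.exists_resolvent z hz
  rwa [hR.resolventAt_eq]

theorem adjoint_resolventAt {z : ℂ} (hz : z.im ≠ 0) :
    ContinuousLinearMap.adjoint (resolventAt T z) = resolventAt T (starRingEnd ℂ z) := by
  symm
  rw [ContinuousLinearMap.eq_adjoint_iff]
  intro y x
  have hz' : (starRingEnd ℂ z).im ≠ 0 := by simpa using hz
  obtain ⟨h1, e1⟩ := (hT.isResolventAt hz).1 x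
  obtain ⟨h2, e2⟩ := (hT.isResolventAt hz').1 y
  conv_lhs => rw [← e1]
  conv_rhs => rw [← e2]
  rw [inner_sub_left, inner_sub_right, inner_smul_left, inner_smul_right]
  have := hT.symm ⟨_, h2⟩ ⟨_, h1⟩
  simp only at this
  rw [this]
  simp

omit [CompleteSpace 𝓗] in
/-- The resolvent identity. -/
theorem resolventAt_sub {z w : ℂ} (hz : z.im ≠ 0) (hw : w.im ≠ 0) :
    resolventAt T z - resolventAt T w = (z - w) • (resolventAt T z * resolventAt T w) := by
  ext x
  obtain ⟨h1, e1⟩ := (hT.isResolventAt hw).1 x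
  have h2 := (hT.isResolventAt hz).2 ⟨_, h1⟩
  have e2 : T ⟨resolventAt T w x, h1⟩ = x + w • resolventAt T w x := by
    rw [← sub_eq_iff_eq_add]; exact e1
  rw [e2] at h2
  simp only [map_add, map_sub, map_smul] at h2
  simp only [sub_apply, smul_apply, mul_apply_eq_comp]
  conv_lhs => enter [2]; rw [← h2]
  module

omit [CompleteSpace 𝓗] in
theorem commute_resolventAt {z w : ℂ} (hz : z.im ≠ 0) (hw : w.im ≠ 0) :
    Commute (resolventAt T z) (resolventAt T w) := by
  by_cases hzw : z = w
  · subst hzw; exact Commute.refl _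
  have h1 := hT.resolventAt_sub hz hw
  have h2 := hT.resolventAt_sub hw hz
  have h3 : (z - w) • (resolventAt T z * resolventAt T w) =
      (z - w) • (resolventAt T w * resolventAt T z) := by
    rw [← h1, ← neg_sub w z, neg_smul, ← h2, neg_sub]
  exact smul_right_injective _ (sub_ne_zero.mpr hzw) h3

omit [CompleteSpace 𝓗] in
theorem norm_resolventAt_le {z : ℂ} (hz : z.im ≠ 0) : ‖resolventAt T z‖ ≤ |z.im|⁻¹ := by
  refine ContinuousLinearMap.opNorm_le_bound _ (by positivity) fun x => ?_
  obtain ⟨h1, e1⟩ := (hT.isResolventAt hz).1 x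
  have h := abs_im_mul_norm_le hT.symm z ⟨_, h1⟩
  simp only at h
  rw [e1] at h
  rwa [inv_mul_eq_div, le_div_iff₀' (abs_pos.mpr hz)]

/-- The orthogonal complement of the range is the kernel of the adjoint, which is the resolvent at
the conjugate point and hence injective. -/
theorem denseRange_resolventAt {z : ℂ} (hz : z.im ≠ 0) : DenseRange (resolventAt T z) := by
  have hz' : (starRingEnd ℂ z).im ≠ 0 := by simpa using hz
  have h : (resolventAt T z).rangeᗮ = ⊥ := by
    rw [ContinuousLinearMap.orthogonal_range, hT.adjoint_resolventAt hz]
    rw [LinearMap.ker_eq_bot']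
    intro x hx
    obtain ⟨h1, e1⟩ := (hT.isResolventAt hz').1 x
    have hx' : resolventAt T (starRingEnd ℂ z) x = 0 := hx
    have h3 : T ⟨_, h1⟩ = 0 := by
      have : (⟨_, h1⟩ : T.domain) = 0 := Subtype.ext hx'
      rw [this, LinearPMap.map_zero]
    rw [h3, hx'] at e1
    simpa using e1.symm
  have h2 := (Submodule.topologicalClosure_eq_top_iff (K := (resolventAt T z).range)).mpr h
  rw [← Submodule.dense_iff_topologicalClosure_eq_top] at h2
  exact h2

theorem signedResolvent_eq (E : ℝ) : signedResolvent T E = (2⁻¹ : ℝ) •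
    (resolventAt T (E + Complex.I) + resolventAt T (starRingEnd ℂ (E + Complex.I))) := by
  rw [signedResolvent, realPart_apply_coe, ContinuousLinearMap.star_eq_adjoint,
    hT.adjoint_resolventAt (im_add_I_ne E)]

theorem norm_signedResolvent_le (E : ℝ) : ‖signedResolvent T E‖ ≤ 1 := by
  rw [hT.signedResolvent_eq, norm_smul]
  have h1 := hT.norm_resolventAt_le (im_add_I_ne E)
  have h2 := hT.norm_resolventAt_le (z := starRingEnd ℂ (E + Complex.I)) (by simp)
  have h3 := norm_add_le (resolventAt T (E + Complex.I))
    (resolventAt T (starRingEnd ℂ (E + Complex.I)))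
  simp at h1 h2 h3 ⊢
  linarith

theorem commute_signedResolvent_posPart (E : ℝ) {z : ℂ} (hz : z.im ≠ 0) :
    Commute (signedResolvent T E)⁺ (resolventAt T z) := by
  have h : Commute (signedResolvent T E) (resolventAt T z) := by
    rw [hT.signedResolvent_eq]
    refine Commute.smul_left (Commute.add_left ?_ ?_) _
    · exact hT.commute_resolventAt (im_add_I_ne E) hz
    · exact hT.commute_resolventAt (by simp) hz
  rw [CFC.posPart_def, cfcₙ_eq_cfc]
  exact h.cfc_real _

/-- The spectral projection commutes with the resolvent. -/
theorem spectralProjection_resolventAt (E : ℝ) {z : ℂ} (hz : z.im ≠ 0) (x : 𝓗) :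
    spectralProjection T E (resolventAt T z x) = resolventAt T z (spectralProjection T E x) := by
  have hz' : (starRingEnd ℂ z).im ≠ 0 := by simpa using hz
  have hinv : ∀ w : ℂ, w.im ≠ 0 → ∀ y ∈ ((signedResolvent T E)⁺).ker,
      resolventAt T w y ∈ ((signedResolvent T E)⁺).ker := by
    intro w hw y hy
    have h := congrArg (fun A => A y) (hT.commute_signedResolvent_posPart E hw).eq
    simp only [mul_apply_eq_comp] at h
    have hy' : (signedResolvent T E)⁺ y = 0 := hy
    rw [hy', map_zero] at h
    exact h
  rw [spectralProjection]
  refine Submodule.eq_starProjection_of_mem_of_inner_eq_zero ?_ ?_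
  · exact hinv z hz _ (Submodule.starProjection_apply_mem _ _)
  · intro w hw
    rw [← map_sub, ← ContinuousLinearMap.adjoint_inner_right, hT.adjoint_resolventAt hz]
    exact Submodule.starProjection_inner_eq_zero _ _ (hinv _ hz' _ hw)

/-- For `φ = (T - E - i)⁻¹ x`, the form of `T - E` at `φ` is the form of the signed resolvent at
`x`. This is how sign information on the signed resolvent is turned into bounds on the form of `T`.
-/
theorem re_inner_resolventAt (E : ℝ) (x : 𝓗) :
    ∃ h : resolventAt T (E + Complex.I) x ∈ T.domain,
      (inner ℂ (resolventAt T (E + Complex.I) x) (T ⟨_, h⟩)).re =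
        E * ‖resolventAt T (E + Complex.I) x‖ ^ 2 + (inner ℂ x (signedResolvent T E x)).re := by
  have hz := im_add_I_ne E
  obtain ⟨h1, e1⟩ := (hT.isResolventAt hz).1 x
  refine ⟨h1, ?_⟩
  rw [hT.signedResolvent_eq]
  generalize hzdef : (E : ℂ) + Complex.I = z at *
  rw [sub_eq_iff_eq_add] at e1
  rw [e1, inner_add_right, inner_smul_right, inner_self_eq_norm_sq_to_K]
  have h2 : (inner ℂ x (resolventAt T (starRingEnd ℂ z) x)).re =
      (inner ℂ (resolventAt T z x) x).re := by
    rw [← hT.adjoint_resolventAt hz, ContinuousLinearMap.adjoint_inner_right]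
  have h3 : (inner ℂ x (resolventAt T z x)).re = (inner ℂ (resolventAt T z x) x).re := by
    rw [← inner_conj_symm, Complex.conj_re]
  rw [smul_apply, add_apply, inner_smul_right_eq_smul, inner_add_right]
  simp only [Complex.add_re, Complex.real_smul, Complex.re_ofReal_mul, h2, h3]
  rw [RCLike.ofReal_eq_complex_ofReal, ← Complex.ofReal_pow, Complex.re_mul_ofReal, ← hzdef]
  simp
  ring

/-- On the range of the spectral projection `1_{(-∞, E]}(T)` the quadratic form of `T` is at most
`E`.  Vectors in this range that lie in the domain of `T` are dense in it, so the bound is stated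
for continuous minorants `f` of the form. -/
theorem apply_spectralProjection_le (E : ℝ) {f : 𝓗 → ℝ} (hf : Continuous f)
    (hfT : ∀ φ : T.domain, f φ ≤ (inner ℂ (φ : 𝓗) (T φ)).re) (ψ : 𝓗) :
    f (spectralProjection T E ψ) ≤ E * ‖spectralProjection T E ψ‖ ^ 2 := by
  have hz := im_add_I_ne E
  refine (hT.denseRange_resolventAt hz).induction_on
    (p := fun ψ => f (spectralProjection T E ψ) ≤ E * ‖spectralProjection T E ψ‖ ^ 2) ψ ?_ ?_
  · exact isClosed_le (by fun_prop) (by fun_prop)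
  · intro x
    rw [hT.spectralProjection_resolventAt E hz]
    obtain ⟨h, e⟩ := hT.re_inner_resolventAt E (spectralProjection T E x)
    refine (hfT ⟨_, h⟩).trans ?_
    have h2 : (inner ℂ (spectralProjection T E x)
        (signedResolvent T E (spectralProjection T E x))).re ≤ 0 :=
      re_inner_signedResolvent_nonpos (Submodule.starProjection_apply_mem _ _)
    simp only
    rw [e]
    linarith

/-- A Chebyshev bound: for nonnegative `T`, the part of `φ` outside the spectral subspace of
energies at most `E` is controlled by the energy of `φ`. -/
theorem mul_norm_sub_spectralProjection_sq_le
    (hpos : ∀ φ : T.domain, 0 ≤ (inner ℂ (φ : 𝓗) (T φ)).re) (E : ℝ) (φ : T.domain) :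
    E * ‖(φ : 𝓗) - spectralProjection T E φ‖ ^ 2 ≤ (inner ℂ (φ : 𝓗) (T φ)).re := by
  have hz := im_add_I_ne E
  set z : ℂ := E + Complex.I with hzdef
  set Q := spectralProjection T E with hQ
  set R := resolventAt T z with hR
  obtain ⟨x, hx⟩ : ∃ x, R x = φ := ⟨_, (hT.isResolventAt hz).2 φ⟩
  have hQφ : Q (φ : 𝓗) = R (Q x) := by rw [← hx]; exact hT.spectralProjection_resolventAt E hz x
  obtain ⟨h1, e1⟩ := hT.re_inner_resolventAt E (x - Q x)
  obtain ⟨h2, -⟩ := hT.re_inner_resolventAt E (Q x)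
  set φ₁ : T.domain := ⟨_, h1⟩ with hφ₁
  set φ₂ : T.domain := ⟨_, h2⟩ with hφ₂
  have hsum : φ = φ₂ + φ₁ := by
    refine Subtype.ext ?_
    change (φ : 𝓗) = R (Q x) + R (x - Q x)
    rw [map_sub, hx]; abel
  have hφ₁' : (φ₁ : 𝓗) = (φ : 𝓗) - Q φ := by
    change R (x - Q x) = _
    rw [map_sub, hx, hQφ]
  -- the two components of `φ` are also orthogonal with respect to the form of `T`
  have hmem : ∀ y, Q y ∈ ((signedResolvent T E)⁺).ker := fun y =>
    Submodule.starProjection_apply_mem _ _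
  have horth : ∀ y, y - Q y ∈ ((signedResolvent T E)⁺).kerᗮ := fun y =>
    Submodule.sub_starProjection_mem_orthogonal y
  have e3 : T φ₁ = (x - Q x) + z • (φ₁ : 𝓗) := by
    obtain ⟨h, e⟩ := (hT.isResolventAt hz).1 (x - Q x)
    rw [sub_eq_iff_eq_add] at e
    exact e
  have hcross : inner ℂ (φ₂ : 𝓗) (T φ₁) = 0 := by
    rw [e3, inner_add_right, inner_smul_right]
    have hm : (φ₂ : 𝓗) ∈ ((signedResolvent T E)⁺).ker := by
      change R (Q x) ∈ _
      rw [← hQφ]; exact hmem _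
    rw [(Submodule.mem_orthogonal _ _).mp (horth x) _ hm, hφ₁',
      (Submodule.mem_orthogonal _ _).mp (horth φ) _ hm]
    simp
  have hcross' : (inner ℂ (φ₁ : 𝓗) (T φ₂)).re = 0 := by
    rw [← hT.symm, ← inner_conj_symm, hcross]; simp
  have hTφ : (inner ℂ (φ : 𝓗) (T φ)).re =
      (inner ℂ (φ₂ : 𝓗) (T φ₂)).re + (inner ℂ (φ₁ : 𝓗) (T φ₁)).re := by
    rw [hsum, LinearPMap.map_add, Submodule.coe_add, inner_add_left, inner_add_right,
      inner_add_right, hcross]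
    simp only [Complex.add_re, hcross', zero_add, add_zero]
  have h4 : 0 ≤ (inner ℂ (x - Q x) (signedResolvent T E (x - Q x))).re :=
    re_inner_signedResolvent_nonneg (horth x)
  have h5 := hpos φ₂
  rw [hTφ, ← hφ₁']
  have e1' : (inner ℂ (φ₁ : 𝓗) (T φ₁)).re = E * ‖(φ₁ : 𝓗)‖ ^ 2 +
      (inner ℂ (x - Q x) (signedResolvent T E (x - Q x))).re := e1
  linarith

end IsSelfAdjointOp

theorem re_inner_spectralProjection_self (T : 𝓗 →ₗ.[ℂ] 𝓗) (E : ℝ) (x : 𝓗) :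
    (inner ℂ x (spectralProjection T E x)).re = ‖spectralProjection T E x‖ ^ 2 := by
  have := Submodule.re_inner_starProjection_eq_normSq (𝕜 := ℂ) ((signedResolvent T E)⁺).ker x
  rw [← inner_conj_symm, Complex.conj_re]
  exact this

theorem norm_spectralProjection_apply_le (T : 𝓗 →ₗ.[ℂ] 𝓗) (E : ℝ) (x : 𝓗) :
    ‖spectralProjection T E x‖ ≤ ‖x‖ := Submodule.norm_starProjection_apply_le _ _

theorem inner_spectralProjection_left (T : 𝓗 →ₗ.[ℂ] 𝓗) (E : ℝ) (x y : 𝓗) :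
    inner ℂ (spectralProjection T E x) y = inner ℂ x (spectralProjection T E y) :=
  Submodule.inner_starProjection_left_eq_right _ _ _

end AbstractSpectral

/-! ### Unitary covariance and measurability of spectral projections -/

section Covariance

variable {𝓗 : Type*} [NormedAddCommGroup 𝓗] [InnerProductSpace ℂ 𝓗] [CompleteSpace 𝓗]

theorem posPart_conjStarAlgEquiv (U : 𝓗 ≃ₗᵢ[ℂ] 𝓗) {A : 𝓗 →L[ℂ] 𝓗} (hA : IsSelfAdjoint A) :
    (U.conjStarAlgEquiv A)⁺ = U.conjStarAlgEquiv A⁺ := by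
  have hnn : ∀ B : 𝓗 →L[ℂ] 𝓗, 0 ≤ B → 0 ≤ U.conjStarAlgEquiv B := by
    intro B hB
    obtain ⟨C, rfl⟩ := CStarAlgebra.nonneg_iff_eq_star_mul_self.mp hB
    rw [map_mul, map_star]
    exact star_mul_self_nonneg _
  refine (CFC.posPart_negPart_unique (c := U.conjStarAlgEquiv A⁻) ?_ ?_
    (hnn _ (CFC.posPart_nonneg A)) (hnn _ (CFC.negPart_nonneg A))).1
  · rw [← map_sub, CFC.posPart_sub_negPart A hA]
  · rw [← map_mul, CFC.posPart_mul_negPart, map_zero]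

/-- If the resolvents of two operators are unitarily equivalent, so are their spectral
projections. -/
theorem spectralProjection_conj (U : 𝓗 ≃ₗᵢ[ℂ] 𝓗) {T T' : 𝓗 →ₗ.[ℂ] 𝓗} (E : ℝ)
    (h : resolventAt T' (E + Complex.I) = U.conjStarAlgEquiv (resolventAt T (E + Complex.I)))
    (x : 𝓗) : spectralProjection T' E (U x) = U (spectralProjection T E x) := by
  have hS : signedResolvent T' E = U.conjStarAlgEquiv (signedResolvent T E) := by
    rw [signedResolvent, signedResolvent, realPart_apply_coe, realPart_apply_coe, h, ← map_star,
      ← map_add]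
    ext y
    simp [RCLike.real_smul_eq_coe_smul (K := ℂ)]
  have hP : (signedResolvent T' E)⁺ = U.conjStarAlgEquiv (signedResolvent T E)⁺ := by
    rw [hS, posPart_conjStarAlgEquiv U (isSelfAdjoint_signedResolvent T E)]
  rw [spectralProjection.eq_1 T']
  refine Submodule.eq_starProjection_of_mem_of_inner_eq_zero ?_ ?_
  · have hm : (signedResolvent T E)⁺ (spectralProjection T E x) = 0 :=
      Submodule.starProjection_apply_mem ((signedResolvent T E)⁺).ker x
    change (signedResolvent T' E)⁺ _ = 0
    rw [hP, LinearIsometryEquiv.conjStarAlgEquiv_apply_apply, U.symm_apply_apply, hm, map_zero]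
  · intro w hw
    have hw' : (signedResolvent T E)⁺ (U.symm w) = 0 := by
      have hw2 : (signedResolvent T' E)⁺ w = 0 := hw
      rw [hP, LinearIsometryEquiv.conjStarAlgEquiv_apply_apply] at hw2
      simpa using hw2
    rw [← map_sub, ← U.apply_symm_apply w, U.inner_map_map]
    exact Submodule.starProjection_inner_eq_zero (K := ((signedResolvent T E)⁺).ker) _ _ hw'

end Covariance

section StrongContinuity

variable {𝓗 : Type*} [NormedAddCommGroup 𝓗] [InnerProductSpace ℂ 𝓗] [CompleteSpace 𝓗]
variable {X : Type*} [TopologicalSpace X]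

omit [CompleteSpace 𝓗] in
theorem continuous_apply_comp {A : X → 𝓗 →L[ℂ] 𝓗} {C : ℝ} (hA : ∀ x, Continuous fun ω => A ω x)
    (hC : ∀ ω, ‖A ω‖ ≤ C) {f : X → 𝓗} (hf : Continuous f) : Continuous fun ω => A ω (f ω) := by
  rw [continuous_iff_continuousAt]
  intro ω₀
  rw [ContinuousAt, tendsto_iff_norm_sub_tendsto_zero]
  have h1 : Tendsto (fun ω => C * ‖f ω - f ω₀‖ + ‖A ω (f ω₀) - A ω₀ (f ω₀)‖) (𝓝 ω₀) (𝓝 0) := by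
    have h2 := tendsto_iff_norm_sub_tendsto_zero.mp (hf.tendsto ω₀)
    have h3 := tendsto_iff_norm_sub_tendsto_zero.mp ((hA (f ω₀)).tendsto ω₀)
    simpa using (h2.const_mul C).add h3
  refine squeeze_zero (fun _ => norm_nonneg _) (fun ω => ?_) h1
  calc ‖A ω (f ω) - A ω₀ (f ω₀)‖ = ‖A ω (f ω - f ω₀) + (A ω (f ω₀) - A ω₀ (f ω₀))‖ := by
        rw [map_sub]; congr 1; abel
    _ ≤ ‖A ω (f ω - f ω₀)‖ + ‖A ω (f ω₀) - A ω₀ (f ω₀)‖ := norm_add_le _ _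
    _ ≤ _ := by gcongr; exact (A ω).le_of_opNorm_le (hC ω) _

omit [CompleteSpace 𝓗] in
theorem continuous_pow_apply {A : X → 𝓗 →L[ℂ] 𝓗} {C : ℝ} (hA : ∀ x, Continuous fun ω => A ω x)
    (hC : ∀ ω, ‖A ω‖ ≤ C) (k : ℕ) (x : 𝓗) : Continuous fun ω => (A ω ^ k) x := by
  induction k with
  | zero => simpa using continuous_const
  | succ k ih =>
    simp only [pow_succ', mul_apply_eq_comp]
    exact continuous_apply_comp hA hC ih

omit [CompleteSpace 𝓗] in
theorem continuous_aeval_apply {A : X → 𝓗 →L[ℂ] 𝓗} {C : ℝ} (hA : ∀ x, Continuous fun ω => A ω x)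
    (hC : ∀ ω, ‖A ω‖ ≤ C) (p : Polynomial ℝ) (x : 𝓗) :
    Continuous fun ω => (Polynomial.aeval (A ω) p) x := by
  simp only [Polynomial.aeval_eq_sum_range, sum_apply, smul_apply]
  exact continuous_finsetSum _ fun i _ => (continuous_pow_apply hA hC i x).const_smul _

theorem spectrum_subset_Icc_of_norm_le_one {S : 𝓗 →L[ℂ] 𝓗} (hS : ‖S‖ ≤ 1) :
    spectrum ℝ S ⊆ Set.Icc (-1) 1 := by
  intro t ht
  have h1 := spectrum.norm_le_norm_mul_of_mem ht
  have h2 : ‖(1 : 𝓗 →L[ℂ] 𝓗)‖ ≤ 1 := ContinuousLinearMap.norm_id_le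
  have h3 : ‖t‖ ≤ 1 := h1.trans (mul_le_one₀ hS (norm_nonneg _) h2)
  exact abs_le.mp h3

/-- The positive part of a strongly continuous family of self-adjoint contractions is strongly
continuous, by polynomial approximation of `t ↦ t⁺` on `[-1, 1]`. -/
theorem continuous_posPart_apply {S : X → 𝓗 →L[ℂ] 𝓗} (hS : ∀ x, Continuous fun ω => S ω x)
    (hsa : ∀ ω, IsSelfAdjoint (S ω)) (h1 : ∀ ω, ‖S ω‖ ≤ 1) (x : 𝓗) :
    Continuous fun ω => (S ω)⁺ x := by
  refine continuous_of_uniform_approx_of_continuous fun u hu => ?_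
  obtain ⟨ε, hε, hεu⟩ := Metric.mem_uniformity_dist.mp hu
  obtain ⟨p, hp⟩ := exists_polynomial_near_of_continuousOn (-1) 1 (fun t => t⁺)
    (by fun_prop) (ε / (‖x‖ + 1)) (by positivity)
  refine ⟨fun ω => (Polynomial.aeval (S ω) p) x, continuous_aeval_apply hS h1 p x, fun ω => ?_⟩
  apply hεu
  have hn : ‖(S ω)⁺ - Polynomial.aeval (S ω) p‖ ≤ ε / (‖x‖ + 1) := by
    rw [CFC.posPart_def, cfcₙ_eq_cfc, ← cfc_polynomial p (S ω) (hsa ω), ← cfc_sub ..]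
    refine norm_cfc_le (by positivity) fun t ht => ?_
    rw [norm_sub_rev]
    exact (hp t (spectrum_subset_Icc_of_norm_le_one (h1 ω) ht)).le
  rw [dist_eq_norm, ← sub_apply]
  calc _ ≤ ε / (‖x‖ + 1) * ‖x‖ := ContinuousLinearMap.le_of_opNorm_le _ hn _
    _ < ε := by
      rw [div_mul_eq_mul_div, div_lt_iff₀ (by positivity)]
      nlinarith [norm_nonneg x]

theorem norm_one_sub_posPart_le {S : 𝓗 →L[ℂ] 𝓗} (hsa : IsSelfAdjoint S) (h1 : ‖S‖ ≤ 1) :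
    ‖1 - S⁺‖ ≤ 1 := by
  rw [CFC.posPart_def, cfcₙ_eq_cfc, ← cfc_one ℝ S, ← cfc_sub ..]
  refine norm_cfc_le zero_le_one fun t ht => ?_
  obtain ⟨h2, h3⟩ := spectrum_subset_Icc_of_norm_le_one h1 ht
  have h4 : 0 ≤ t⁺ := posPart_nonneg t
  have h5 : t⁺ ≤ 1 := by
    rw [posPart_def]; exact sup_le h3 zero_le_one
  rw [Real.norm_eq_abs, abs_le]
  simp only [Pi.one_apply]
  constructor <;> linarith

/-- Matrix elements of the projection onto the kernel of the positive part of a strongly continuous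
family are measurable: by the mean ergodic theorem, this projection is the strong limit of the
averages of the powers of `1 - S⁺`. -/
theorem measurable_inner_starProjection_ker_posPart [MeasurableSpace X] [OpensMeasurableSpace X]
    {S : X → 𝓗 →L[ℂ] 𝓗} (hS : ∀ x, Continuous fun ω => S ω x)
    (hsa : ∀ ω, IsSelfAdjoint (S ω)) (h1 : ∀ ω, ‖S ω‖ ≤ 1) (x y : 𝓗) :
    Measurable fun ω => inner ℂ y ((S ω)⁺.ker.starProjection x) := by
  have hcont : ∀ k : ℕ, Continuous fun ω => (⇑(1 - (S ω)⁺))^[k] x := by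
    intro k
    induction k with
    | zero => exact continuous_const
    | succ k ih =>
      simp only [Function.iterate_succ_apply']
      refine continuous_apply_comp (A := fun ω => 1 - (S ω)⁺) (C := 1) (fun z => ?_)
        (fun ω => norm_one_sub_posPart_le (hsa ω) (h1 ω)) ih
      simp only [sub_apply]
      exact continuous_const.sub (continuous_posPart_apply hS hsa h1 z)
  refine measurable_of_tendsto_metrizable (f := fun (n : ℕ) ω =>
    inner ℂ y (birkhoffAverage ℂ (⇑(1 - (S ω)⁺)) id n x)) (fun n => ?_) ?_
  · refine Continuous.measurable ?_
    simp only [birkhoffAverage, birkhoffSum, id]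
    exact continuous_const.inner ((continuous_finsetSum _ fun k _ => hcont k).const_smul _)
  · rw [tendsto_pi_nhds]
    intro ω
    have h := ContinuousLinearMap.tendsto_birkhoffAverage_orthogonalProjection (1 - (S ω)⁺)
      (norm_one_sub_posPart_le (hsa ω) (h1 ω)) x
    have hker : ((1 - (S ω)⁺ : 𝓗 →L[ℂ] 𝓗) : 𝓗 →ₗ[ℂ] 𝓗).eqLocus ((1 : 𝓗 →L[ℂ] 𝓗) : 𝓗 →ₗ[ℂ] 𝓗) =
        (S ω)⁺.ker := by
      ext z
      simp [LinearMap.mem_eqLocus]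
    have hproj : ∀ (K : Submodule ℂ 𝓗) [K.HasOrthogonalProjection], K = (S ω)⁺.ker →
        K.starProjection x = (S ω)⁺.ker.starProjection x := by
      rintro K _ rfl
      rfl
    rw [← hproj _ hker]
    exact tendsto_const_nhds.inner h

end StrongContinuity

/-! ### Translations and the canonical basis -/

theorem commute_fracPow {𝓗 : Type*} [NormedAddCommGroup 𝓗] [InnerProductSpace ℂ 𝓗]
    [CompleteSpace 𝓗] {A B : 𝓗 →L[ℂ] 𝓗} (h : Commute A B) (α : ℝ) : Commute (fracPow A α) B :=
  h.cfc_nnreal _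

section Model

variable {d : ℕ}

theorem translation_apply (v : Lattice d) (φ : L2 d) (n : Lattice d) :
    (translation v φ : Lattice d → ℂ) n = (φ : Lattice d → ℂ) (n + v) := rfl

theorem translation_translation (v w : Lattice d) (φ : L2 d) :
    translation v (translation w φ) = translation (v + w) φ := by
  ext n
  simp only [translation_apply, add_assoc]

theorem translation_zero : translation (0 : Lattice d) = 1 := by
  ext φ n
  simp [translation_apply]

theorem norm_translation_apply (v : Lattice d) (φ : L2 d) : ‖translation v φ‖ = ‖φ‖ := by
  rw [lp.norm_eq_tsum_rpow (by norm_num), lp.norm_eq_tsum_rpow (by norm_num)]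
  exact congrArg (· ^ (1 / (2 : ℝ≥0∞).toReal))
    ((Equiv.addRight v).tsum_eq (fun n => ‖(φ : Lattice d → ℂ) n‖ ^ (2 : ℝ≥0∞).toReal))

/-- The translation as a unitary operator. -/
def translationEquiv (v : Lattice d) : L2 d ≃ₗᵢ[ℂ] L2 d where
  toFun := translation v
  map_add' := map_add _
  map_smul' := map_smul _
  invFun := translation (-v)
  left_inv φ := by rw [translation_translation, neg_add_cancel, translation_zero]; rfl
  right_inv φ := by rw [translation_translation, add_neg_cancel, translation_zero]; rfl
  norm_map' := norm_translation_apply v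

theorem translationEquiv_apply (v : Lattice d) (φ : L2 d) :
    translationEquiv v φ = translation v φ := rfl

theorem star_translation (v : Lattice d) : star (translation v) = translation (-v) := by
  rw [ContinuousLinearMap.star_eq_adjoint]
  symm
  rw [ContinuousLinearMap.eq_adjoint_iff]
  intro x y
  rw [← (translationEquiv v).inner_map_map, translationEquiv_apply, translationEquiv_apply,
    translation_translation, add_neg_cancel, translation_zero]
  rfl

theorem inner_delta_left (n : Lattice d) (φ : L2 d) :
    inner ℂ (delta n) φ = (φ : Lattice d → ℂ) n := by
  rw [delta, lp.inner_single_left]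
  simp

theorem norm_delta (n : Lattice d) : ‖(delta n : L2 d)‖ = 1 := by
  rw [delta, lp.norm_single (by norm_num)]
  simp

theorem delta_apply (n m : Lattice d) :
    (delta n : Lattice d → ℂ) m = if m = n then 1 else 0 := by
  rw [delta, lp.single_apply, Pi.single_apply]

theorem translation_delta (v n : Lattice d) : translation v (delta n) = delta (n - v) := by
  ext m
  simp only [translation_apply, delta_apply, eq_sub_iff_add_eq]

theorem norm_sq_eq_tsum (φ : L2 d) : ‖φ‖ ^ 2 = ∑' n, ‖(φ : Lattice d → ℂ) n‖ ^ 2 := by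
  have := lp.norm_rpow_eq_tsum (p := 2) (by norm_num) φ
  simpa using this

theorem summable_norm_sq (φ : L2 d) : Summable fun n => ‖(φ : Lattice d → ℂ) n‖ ^ 2 := by
  have := (lp.memℓp φ).summable (by norm_num)
  simpa using this

/-! ### Self-adjointness of the Hamiltonian and its dependence on the potential -/

theorem isSelfAdjoint_fracLaplacian (d : ℕ) (α : ℝ) : IsSelfAdjoint (fracLaplacian d α) :=
  IsSelfAdjoint.of_nonneg CFC.rpow_nonneg

theorem inner_fracLaplacian_left (α : ℝ) (φ ψ : L2 d) :
    inner ℂ (fracLaplacian d α φ) ψ = inner ℂ φ (fracLaplacian d α ψ) := by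
  have h := ContinuousLinearMap.adjoint_inner_left (fracLaplacian d α) ψ φ
  rwa [← ContinuousLinearMap.star_eq_adjoint, (isSelfAdjoint_fracLaplacian d α).star_eq] at h

theorem mem_hamiltonian_domain {α lam : ℝ} {ω : Lattice d → ℝ} {φ : L2 d} :
    φ ∈ (hamiltonian α lam ω).domain ↔
      Memℓp (fun n => (ω n : ℂ) * (φ : Lattice d → ℂ) n) 2 := Iff.rfl

theorem hamiltonian_apply {α lam : ℝ} {ω : Lattice d → ℝ} (φ : (hamiltonian α lam ω).domain) :
    hamiltonian α lam ω φ = fracLaplacian d α φ + (lam : ℂ) • potential ω ⟨φ, φ.2⟩ := rfl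

theorem potential_apply {ω : Lattice d → ℝ} (φ : (potential ω).domain) (n : Lattice d) :
    (potential ω φ : Lattice d → ℂ) n = ω n * ((φ : L2 d) : Lattice d → ℂ) n := rfl

theorem potential_symm (ω : Lattice d → ℝ) : (potential ω).IsFormalAdjoint (potential ω) := by
  intro φ ψ
  rw [lp.inner_eq_tsum, lp.inner_eq_tsum]
  refine tsum_congr fun n => ?_
  simp only [potential_apply, RCLike.inner_apply, map_mul, Complex.conj_ofReal]
  ring

theorem hamiltonian_symm (α lam : ℝ) (ω : Lattice d → ℝ) :
    (hamiltonian α lam ω).IsFormalAdjoint (hamiltonian α lam ω) := by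
  intro φ ψ
  rw [hamiltonian_apply, hamiltonian_apply, inner_add_left, inner_add_right, inner_smul_left,
    inner_smul_right, inner_fracLaplacian_left, Complex.conj_ofReal]
  congr 2
  exact potential_symm ω ⟨φ, φ.2⟩ ⟨ψ, ψ.2⟩

theorem memℓp_mul_delta (ω : Lattice d → ℝ) (n : Lattice d) :
    Memℓp (fun m => (ω m : ℂ) * (delta n : Lattice d → ℂ) m) 2 := by
  have h : (fun m => (ω m : ℂ) * (delta n : Lattice d → ℂ) m) =
      (((ω n : ℂ) • delta n : L2 d) : Lattice d → ℂ) := by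
    funext m
    rw [lp.coeFn_smul, Pi.smul_apply, smul_eq_mul, delta_apply]
    split_ifs with hm
    · rw [hm]
    · simp
  rw [h]
  exact lp.memℓp _

theorem hamiltonian_delta {α lam : ℝ} {ω : Lattice d → ℝ} (n : Lattice d)
    (h : delta n ∈ (hamiltonian α lam ω).domain) :
    hamiltonian α lam ω ⟨delta n, h⟩ =
      fracLaplacian d α (delta n) + ((lam * ω n : ℝ) : ℂ) • delta n := by
  rw [hamiltonian_apply, Complex.ofReal_mul, mul_smul]
  congr 2
  ext m
  rw [potential_apply, lp.coeFn_smul, Pi.smul_apply, smul_eq_mul]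
  simp only [delta_apply]
  split_ifs with hm
  · rw [hm]
  · simp

/-- The vectors `(H - z) δ_n` span a dense subspace: a vector orthogonal to all of them is an
eigenvector of `H` for the non-real number `conj z`. -/
theorem eq_zero_of_inner_hamiltonian_delta {α lam : ℝ} (hlam : lam ≠ 0) {ω : Lattice d → ℝ} {z : ℂ}
    (hz : z.im ≠ 0) {y : L2 d}
    (hy : ∀ n, inner ℂ (fracLaplacian d α (delta n) + ((lam * ω n : ℝ) : ℂ) • delta n -
      z • delta n) y = 0) : y = 0 := by
  have hy2 : ∀ n, (lam : ℂ) * (ω n * (y : Lattice d → ℂ) n) =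
      starRingEnd ℂ z * (y : Lattice d → ℂ) n - (fracLaplacian d α y : Lattice d → ℂ) n := by
    intro n
    have h := hy n
    rw [inner_sub_left, inner_add_left, inner_fracLaplacian_left, inner_smul_left,
      inner_smul_left, Complex.conj_ofReal, inner_delta_left, inner_delta_left] at h
    rw [Complex.ofReal_mul] at h
    linear_combination h
  have hdom : y ∈ (hamiltonian α lam ω).domain := by
    rw [mem_hamiltonian_domain]
    have h : (fun n => (ω n : ℂ) * (y : Lattice d → ℂ) n) =
        (((lam : ℂ)⁻¹ • (starRingEnd ℂ z • y - fracLaplacian d α y) : L2 d) : Lattice d → ℂ) := by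
      funext n
      have hl : (lam : ℂ) ≠ 0 := by exact_mod_cast hlam
      rw [lp.coeFn_smul, lp.coeFn_sub, lp.coeFn_smul, Pi.smul_apply, Pi.sub_apply, Pi.smul_apply,
        smul_eq_mul, smul_eq_mul, ← hy2 n, inv_mul_cancel_left₀ hl]
    rw [h]
    exact lp.memℓp _
  have heig : hamiltonian α lam ω ⟨y, hdom⟩ - starRingEnd ℂ z • y = 0 := by
    ext n
    rw [hamiltonian_apply, lp.coeFn_sub, lp.coeFn_add, lp.coeFn_smul, lp.coeFn_smul]
    simp only [Pi.sub_apply, Pi.add_apply, Pi.smul_apply, smul_eq_mul, potential_apply, hy2 n]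
    simp
  have h := abs_im_mul_norm_le (hamiltonian_symm α lam ω) (starRingEnd ℂ z) ⟨y, hdom⟩
  simp only [heig, norm_zero, Complex.conj_im, abs_neg] at h
  have h2 : ‖y‖ ≤ 0 := by
    by_contra hcon
    push Not at hcon
    exact absurd h (not_le.mpr (mul_pos (abs_pos.mpr hz) hcon))
  exact norm_le_zero_iff.mp h2

/-- The range of `H - z` is dense by `eq_zero_of_inner_hamiltonian_delta`, and closed because
`H - z` is bounded below and `H` is closed. -/
theorem hamiltonian_sub_surjective {α lam : ℝ} (hlam : lam ≠ 0) (ω : Lattice d → ℝ) {z : ℂ}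
    (hz : z.im ≠ 0) (x : L2 d) :
    ∃ φ : (hamiltonian α lam ω).domain, hamiltonian α lam ω φ - z • (φ : L2 d) = x := by
  set H := hamiltonian α lam ω with hH
  let f : H.domain →ₗ[ℂ] L2 d := H.toFun - z • H.domain.subtype
  have hf : ∀ φ : H.domain, f φ = H φ - z • (φ : L2 d) := fun φ => rfl
  have hclosed : IsClosed (f.range : Set (L2 d)) := by
    rw [← isSeqClosed_iff_isClosed]
    intro u y hu huy
    choose φ hφ using hu
    have hc : CauchySeq fun k => (φ k : L2 d) := by
      have hu' := huy.cauchySeq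
      rw [Metric.cauchySeq_iff] at hu' ⊢
      intro ε hε
      obtain ⟨N, hN⟩ := hu' (|z.im| * ε) (mul_pos (abs_pos.mpr hz) hε)
      refine ⟨N, fun m hm n hn => ?_⟩
      have h1 := hN m hm n hn
      have h2 := abs_im_mul_norm_le (hamiltonian_symm α lam ω) z (φ m - φ n)
      rw [dist_eq_norm, ← hφ, ← hφ, ← map_sub, hf] at h1
      have h3 := h2.trans_lt h1
      rw [dist_eq_norm]
      exact lt_of_mul_lt_mul_left h3 (abs_nonneg _)
    obtain ⟨ψ, hψ⟩ := cauchySeq_tendsto_of_complete hc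
    -- the potential energies converge too, and the limit is `V ψ` because it is so pointwise
    set χ : L2 d := (lam : ℂ)⁻¹ • (y - fracLaplacian d α ψ + z • ψ) with hχ
    have hl : (lam : ℂ) ≠ 0 := by exact_mod_cast hlam
    have hV : ∀ k, potential ω ⟨φ k, (φ k).2⟩ =
        (lam : ℂ)⁻¹ • (u k - fracLaplacian d α (φ k) + z • (φ k : L2 d)) := by
      intro k
      have hu : u k = fracLaplacian d α (φ k) + (lam : ℂ) • potential ω ⟨φ k, (φ k).2⟩ -
          z • (φ k : L2 d) := by
        rw [← hφ, hf]
        exact congrArg (· - z • (φ k : L2 d)) (hamiltonian_apply (φ k))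
      rw [hu, sub_right_comm, sub_add_cancel, add_sub_cancel_left, inv_smul_smul₀ hl]
    have hVlim : Tendsto (fun k => potential ω ⟨φ k, (φ k).2⟩) atTop (𝓝 χ) := by
      simp only [hV]
      exact ((huy.sub (((fracLaplacian d α).continuous.tendsto ψ).comp hψ)).add
        (hψ.const_smul z)).const_smul _
    have hcoord : ∀ (n : Lattice d), Continuous fun φ : L2 d => (φ : Lattice d → ℂ) n := by
      intro n
      simp only [← inner_delta_left]
      fun_prop
    have hpt : ∀ n, (ω n : ℂ) * (ψ : Lattice d → ℂ) n = (χ : Lattice d → ℂ) n := by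
      intro n
      have h1 := ((hcoord n).tendsto χ).comp hVlim
      have h2 := (((hcoord n).tendsto ψ).comp hψ).const_mul (ω n : ℂ)
      exact tendsto_nhds_unique h2 h1
    have hdom : ψ ∈ H.domain := by
      rw [hH, mem_hamiltonian_domain]
      simp only [hpt]
      exact lp.memℓp χ
    refine ⟨⟨ψ, hdom⟩, ?_⟩
    have hVψ : potential ω ⟨ψ, hdom⟩ = χ := by
      ext n
      rw [potential_apply, hpt]
    have : H ⟨ψ, hdom⟩ = fracLaplacian d α ψ + (lam : ℂ) • χ := by
      rw [← hVψ]; exact hamiltonian_apply _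
    rw [hf, this, hχ, smul_inv_smul₀ hl]
    abel
  have htop : f.range = ⊤ := by
    have : CompleteSpace f.range := hclosed.completeSpace_coe
    rw [← Submodule.orthogonal_eq_bot_iff, Submodule.eq_bot_iff]
    intro y hy
    refine eq_zero_of_inner_hamiltonian_delta (α := α) (ω := ω) hlam hz fun n => ?_
    have hd : delta n ∈ H.domain := memℓp_mul_delta ω n
    rw [← hamiltonian_delta n hd]
    exact (Submodule.mem_orthogonal _ _).mp hy _ ⟨⟨delta n, hd⟩, rfl⟩
  have hx : x ∈ f.range := htop ▸ Submodule.mem_top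
  obtain ⟨φ, hφ⟩ := hx
  exact ⟨φ, hφ⟩

theorem isSelfAdjointOp_hamiltonian (α : ℝ) {lam : ℝ} (hlam : lam ≠ 0) (ω : Lattice d → ℝ) :
    IsSelfAdjointOp (hamiltonian α lam ω) where
  symm := hamiltonian_symm α lam ω
  exists_resolvent _ hz :=
    exists_isResolventAt (hamiltonian_symm α lam ω) hz (hamiltonian_sub_surjective hlam ω hz)

/-- The resolvent of `H_ω` depends strongly continuously on `ω` in the product topology.  The
resolvents are uniformly bounded, and on the dense span of the vectors `(H_{ω₀} - z) δ_n` the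
continuity at `ω₀` is explicit, since each of them involves a single coordinate of `ω`. -/
theorem continuous_resolventAt_hamiltonian (α : ℝ) {lam : ℝ} (hlam : lam ≠ 0) {z : ℂ}
    (hz : z.im ≠ 0) (x : L2 d) :
    Continuous fun ω : Lattice d → ℝ => resolventAt (hamiltonian α lam ω) z x := by
  rw [continuous_iff_continuousAt]
  intro ω₀
  set R : (Lattice d → ℝ) → L2 d →L[ℂ] L2 d := fun ω => resolventAt (hamiltonian α lam ω) z with hR
  have hbound : ∀ ω, ‖R ω‖ ≤ |z.im|⁻¹ := fun ω =>
    (isSelfAdjointOp_hamiltonian α hlam ω).norm_resolventAt_le hz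
  let M : Submodule ℂ (L2 d) :=
    { carrier := {x | Tendsto (fun ω => R ω x) (𝓝 ω₀) (𝓝 (R ω₀ x))}
      add_mem' := fun {a b} ha hb => by
        simp only [Set.mem_ofPred_eq, map_add] at *
        exact ha.add hb
      zero_mem' := by
        simp only [Set.mem_ofPred_eq, map_zero]
        exact tendsto_const_nhds
      smul_mem' := fun c a ha => by
        simp only [Set.mem_ofPred_eq, map_smul] at *
        exact ha.const_smul c }
  have hMdelta : ∀ n, fracLaplacian d α (delta n) + ((lam * ω₀ n : ℝ) : ℂ) • delta n -
      z • delta n ∈ M := by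
    intro n
    have hω : ∀ ω : Lattice d → ℝ, R ω (fracLaplacian d α (delta n) +
        ((lam * ω₀ n : ℝ) : ℂ) • delta n - z • delta n) =
        delta n + ((lam * (ω₀ n - ω n) : ℝ) : ℂ) • R ω (delta n) := by
      intro ω
      have hd : delta n ∈ (hamiltonian α lam ω).domain := memℓp_mul_delta ω n
      have h := ((isSelfAdjointOp_hamiltonian α hlam ω).isResolventAt hz).2 ⟨delta n, hd⟩
      rw [hamiltonian_delta n hd] at h
      simp only at h
      have h' : R ω (fracLaplacian d α (delta n) + ((lam * ω n : ℝ) : ℂ) • delta n -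
        z • delta n) = delta n := h
      have hsplit : fracLaplacian d α (delta n) + ((lam * ω₀ n : ℝ) : ℂ) • delta n - z • delta n =
          (fracLaplacian d α (delta n) + ((lam * ω n : ℝ) : ℂ) • delta n - z • delta n) +
            ((lam * (ω₀ n - ω n) : ℝ) : ℂ) • delta n := by
        push_cast
        module
      rw [hsplit, map_add, map_smul, h']
    change Tendsto _ _ _
    simp only [hω, sub_self, mul_zero, Complex.ofReal_zero, zero_smul]
    refine Tendsto.add tendsto_const_nhds ?_
    refine squeeze_zero_norm (a := fun ω => |lam * (ω₀ n - ω n)| * |z.im|⁻¹) (fun ω => ?_) ?_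
    · rw [norm_smul, Complex.norm_real, Real.norm_eq_abs]
      gcongr
      refine (R ω).le_of_opNorm_le_of_le (hbound ω) (norm_delta n).le |>.trans (by simp)
    · have : Continuous fun ω : Lattice d → ℝ => |lam * (ω₀ n - ω n)| * |z.im|⁻¹ := by fun_prop
      simpa using this.tendsto ω₀
  have hdense : Dense (M : Set (L2 d)) := by
    rw [Submodule.dense_iff_topologicalClosure_eq_top, Submodule.topologicalClosure_eq_top_iff,
      Submodule.eq_bot_iff]
    intro y hy
    exact eq_zero_of_inner_hamiltonian_delta (α := α) (ω := ω₀) hlam hz fun n =>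
      (Submodule.mem_orthogonal _ _).mp hy _ (hMdelta n)
  rw [ContinuousAt, Metric.tendsto_nhds]
  intro ε hε
  set C := |z.im|⁻¹ with hC
  have hC0 : 0 < C := inv_pos.mpr (abs_pos.mpr hz)
  obtain ⟨x', hx', hxx'⟩ := Metric.dense_iff.mp hdense x (ε / (4 * C)) (by positivity)
  rw [Metric.mem_ball, dist_eq_norm, lt_div_iff₀ (by positivity)] at hx'
  have hx'' : Tendsto (fun ω => R ω x') (𝓝 ω₀) (𝓝 (R ω₀ x')) := hxx'
  filter_upwards [Metric.tendsto_nhds.mp hx'' (ε / 2) (by positivity)] with ω hω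
  rw [dist_eq_norm] at hω ⊢
  have h1 := (R ω).le_of_opNorm_le (hbound ω) (x' - x)
  have h2 := (R ω₀).le_of_opNorm_le (hbound ω₀) (x' - x)
  rw [map_sub] at h1 h2
  calc ‖R ω x - R ω₀ x‖ = ‖(R ω x' - R ω₀ x') - (R ω x' - R ω x) + (R ω₀ x' - R ω₀ x)‖ := by
        congr 1; abel
    _ ≤ ‖R ω x' - R ω₀ x'‖ + ‖R ω x' - R ω x‖ + ‖R ω₀ x' - R ω₀ x‖ :=
        (norm_add_le _ _).trans (add_le_add_left (norm_sub_le _ _) _)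
    _ < ε := by nlinarith

theorem measurable_inner_spectralProjection (α : ℝ) {lam : ℝ} (hlam : lam ≠ 0) (E : ℝ)
    (x y : L2 d) : Measurable fun ω : Lattice d → ℝ =>
      inner ℂ y (spectralProjection (hamiltonian α lam ω) E x) := by
  refine measurable_inner_starProjection_ker_posPart (fun z => ?_)
    (fun ω => isSelfAdjoint_signedResolvent _ _)
    (fun ω => (isSelfAdjointOp_hamiltonian α hlam ω).norm_signedResolvent_le E) x y
  simp only [fun ω : Lattice d → ℝ => (isSelfAdjointOp_hamiltonian α hlam ω).signedResolvent_eq E]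
  have hz : (starRingEnd ℂ (E + Complex.I)).im ≠ 0 := by simp
  have h := (continuous_resolventAt_hamiltonian α hlam (im_add_I_ne E) z).add
    (continuous_resolventAt_hamiltonian α hlam hz z)
  exact h.const_smul (2⁻¹ : ℝ)

/-! ### Translation covariance of the Hamiltonian -/

theorem commute_translation (v w : Lattice d) : Commute (translation v) (translation w) := by
  ext φ : 1
  simp only [mul_apply_eq_comp, translation_translation, add_comm]

theorem commute_fracLaplacian_translation (α : ℝ) (v : Lattice d) :
    Commute (fracLaplacian d α) (translation v) := by
  have h : Commute (negLaplacian d) (translation v) := by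
    refine Commute.sum_left _ _ _ fun j _ => ?_
    refine Commute.add_left ?_ ?_ <;>
      exact (Commute.one_left _).sub_left (commute_translation _ _)
  exact commute_fracPow h α

theorem fracLaplacian_translation (α : ℝ) (v : Lattice d) (φ : L2 d) :
    fracLaplacian d α (translation v φ) = translation v (fracLaplacian d α φ) :=
  congrArg (fun A : L2 d →L[ℂ] L2 d => A φ) (commute_fracLaplacian_translation α v).eq

theorem hamiltonian_translation {α lam : ℝ} {ω : Lattice d → ℝ} (v : Lattice d)
    (φ : (hamiltonian α lam ω).domain) :
    ∃ h : translation v (φ : L2 d) ∈ (hamiltonian α lam fun n => ω (n + v)).domain,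
      hamiltonian α lam (fun n => ω (n + v)) ⟨translation v (φ : L2 d), h⟩ =
        translation v (hamiltonian α lam ω φ) := by
  have h : translation v (φ : L2 d) ∈ (hamiltonian α lam fun n => ω (n + v)).domain :=
    memℓp_comp_add (potential ω ⟨φ, φ.2⟩) v
  refine ⟨h, ?_⟩
  rw [hamiltonian_apply, hamiltonian_apply, map_add, map_smul]
  simp only [fracLaplacian_translation]
  rfl

theorem resolventAt_hamiltonian_shift (α : ℝ) {lam : ℝ} (hlam : lam ≠ 0) (ω : Lattice d → ℝ)
    (v : Lattice d) {z : ℂ} (hz : z.im ≠ 0) :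
    resolventAt (hamiltonian α lam fun n => ω (n + v)) z =
      (translationEquiv v).conjStarAlgEquiv (resolventAt (hamiltonian α lam ω) z) := by
  have hR := (isSelfAdjointOp_hamiltonian α hlam ω).isResolventAt hz
  have hR' := (isSelfAdjointOp_hamiltonian α hlam fun n => ω (n + v)).isResolventAt hz
  ext x : 1
  rw [LinearIsometryEquiv.conjStarAlgEquiv_apply_apply]
  obtain ⟨h1, e1⟩ := hR.1 ((translationEquiv v).symm x)
  obtain ⟨h2, e2⟩ := hamiltonian_translation v ⟨_, h1⟩
  have h3 := hR'.2 ⟨_, h2⟩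
  rw [e2] at h3
  simp only at h3
  rw [← map_smul, ← map_sub, e1, ← translationEquiv_apply,
    LinearIsometryEquiv.apply_symm_apply] at h3
  exact h3

theorem spectralProjection_hamiltonian_shift (α : ℝ) {lam : ℝ} (hlam : lam ≠ 0)
    (ω : Lattice d → ℝ) (v : Lattice d) (E : ℝ) (x : L2 d) :
    spectralProjection (hamiltonian α lam fun n => ω (n + v)) E (translation v x) =
      translation v (spectralProjection (hamiltonian α lam ω) E x) :=
  spectralProjection_conj (translationEquiv v) E
    (resolventAt_hamiltonian_shift α hlam ω v (im_add_I_ne E)) x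

end Model

/-! ### Operator inequalities for fractional powers -/

section OperatorInequalities

variable {𝓗 : Type*} [NormedAddCommGroup 𝓗] [InnerProductSpace ℂ 𝓗] [CompleteSpace 𝓗]

theorem re_inner_le_re_inner {A B : 𝓗 →L[ℂ] 𝓗} (h : A ≤ B) (x : 𝓗) :
    (inner ℂ x (A x)).re ≤ (inner ℂ x (B x)).re := by
  have := re_inner_nonneg (sub_nonneg.mpr h) x
  rw [sub_apply, inner_sub_right, Complex.sub_re] at this
  linarith

theorem fracPow_nonneg (A : 𝓗 →L[ℂ] 𝓗) (α : ℝ) : 0 ≤ fracPow A α := CFC.rpow_nonneg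

theorem spectrum_subset_Icc_of_norm_le {B : 𝓗 →L[ℂ] 𝓗} (hB : 0 ≤ B) {M : ℝ} (hM : ‖B‖ ≤ M) :
    spectrum ℝ B ⊆ Set.Icc 0 M := by
  intro t ht
  have h1 := spectrum.norm_le_norm_mul_of_mem ht
  have h2 : ‖(1 : 𝓗 →L[ℂ] 𝓗)‖ ≤ 1 := ContinuousLinearMap.norm_id_le
  have h3 : ‖t‖ ≤ M := h1.trans ((mul_le_of_le_one_right (norm_nonneg _) h2).trans hM)
  exact ⟨spectrum_nonneg_of_nonneg hB ht, (le_abs_self t).trans h3⟩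

/-- Combination of `x ≤ M ^ (1 - α) * x ^ α` on `[0, M]` with the Löwner-Heinz inequality. -/
theorem re_inner_le_rpow_mul_fracPow {A B : 𝓗 →L[ℂ] 𝓗} (hB : 0 ≤ B) (hBA : B ≤ A) {M α : ℝ}
    (hM : ‖B‖ ≤ M) (hα₀ : 0 < α) (hα₁ : α ≤ 1) (x : 𝓗) :
    (inner ℂ x (B x)).re ≤ M ^ (1 - α) * (inner ℂ x (fracPow A α x)).re := by
  have h1 : B ≤ (M ^ (1 - α)) • fracPow B α := by
    have hcont : Continuous fun t : ℝ => t ^ α := Real.continuous_rpow_const hα₀.le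
    rw [fracPow, CFC.rpow_eq_cfc_real hB, ← cfc_smul _ _ _ hcont.continuousOn]
    nth_rewrite 1 [← cfc_id' ℝ B]
    refine cfc_mono (fun t ht => ?_) (by fun_prop) ?_
    · obtain ⟨ht0, htM⟩ := spectrum_subset_Icc_of_norm_le hB hM ht
      rcases ht0.eq_or_lt with rfl | ht0
      · simp [Real.zero_rpow hα₀.ne']
      · calc t = t ^ (1 - α) * t ^ α := by rw [← Real.rpow_add ht0]; simp
          _ ≤ M ^ (1 - α) * t ^ α := by
            gcongr
    · simp only [smul_eq_mul]
      exact (continuous_const.mul hcont).continuousOn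
  have h2 : fracPow B α ≤ fracPow A α := CFC.rpow_le_rpow ⟨hα₀.le, hα₁⟩ hBA
  have h3 := re_inner_le_re_inner h1 x
  rw [smul_apply, inner_smul_right_eq_smul, Complex.real_smul, Complex.re_ofReal_mul] at h3
  have hM0 : 0 ≤ M := (norm_nonneg _).trans hM
  exact h3.trans (mul_le_mul_of_nonneg_left (re_inner_le_re_inner h2 x) (by positivity))

/-- Jensen's inequality for the concave function `t ↦ t ^ α`, in the form given by Young's
inequality `s ^ (1 - α) * t ^ α ≤ α * t + (1 - α) * s`. -/
theorem re_inner_fracPow_le {A : 𝓗 →L[ℂ] 𝓗} (hA : 0 ≤ A) {s α : ℝ} (hs : 0 < s) (hα₀ : 0 < α)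
    (hα₁ : α ≤ 1) {x : 𝓗} (hx : (inner ℂ x (A x)).re ≤ s * ‖x‖ ^ 2) :
    (inner ℂ x (fracPow A α x)).re ≤ s ^ α * ‖x‖ ^ 2 := by
  have h1 : (s ^ (1 - α)) • fracPow A α ≤ α • A + ((1 - α) * s) • (1 : 𝓗 →L[ℂ] 𝓗) := by
    have hcont : Continuous fun t : ℝ => t ^ α := Real.continuous_rpow_const hα₀.le
    rw [fracPow, CFC.rpow_eq_cfc_real hA, ← cfc_smul _ _ _ hcont.continuousOn]
    have h2 : α • A + ((1 - α) * s) • (1 : 𝓗 →L[ℂ] 𝓗) =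
        cfc (fun t : ℝ => α * t + (1 - α) * s) A := by
      rw [cfc_add_const .., cfc_const_mul .., cfc_id' ℝ A, Algebra.algebraMap_eq_smul_one]
    rw [h2]
    refine cfc_mono (fun t ht => ?_) ?_ (by fun_prop)
    · have ht0 : 0 ≤ t := spectrum_nonneg_of_nonneg hA ht
      have := Real.geom_mean_le_arith_mean2_weighted hα₀.le (sub_nonneg.mpr hα₁) ht0 hs.le (by ring)
      rw [smul_eq_mul, mul_comm]
      exact this
    · simp only [smul_eq_mul]
      exact (continuous_const.mul hcont).continuousOn
  have h3 := re_inner_le_re_inner h1 x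
  simp only [add_apply, smul_apply, inner_smul_right_eq_smul, inner_add_right, Complex.add_re,
    Complex.real_smul, Complex.re_ofReal_mul, one_apply_eq_self] at h3
  rw [inner_self_eq_norm_sq_to_K, RCLike.ofReal_eq_complex_ofReal, ← Complex.ofReal_pow,
    Complex.ofReal_re] at h3
  have h4 : s ^ (1 - α) * (inner ℂ x (fracPow A α x)).re ≤ s ^ (1 - α) * (s ^ α * ‖x‖ ^ 2) := by
    rw [← mul_assoc, ← Real.rpow_add hs, sub_add_cancel, Real.rpow_one]
    nlinarith
  exact le_of_mul_le_mul_left h4 (by positivity)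

theorem re_inner_star_mul_self (D : 𝓗 →L[ℂ] 𝓗) (x : 𝓗) :
    (inner ℂ x ((star D * D) x)).re = ‖D x‖ ^ 2 := by
  rw [mul_apply_eq_comp, ContinuousLinearMap.star_eq_adjoint,
    ContinuousLinearMap.adjoint_inner_right, inner_self_eq_norm_sq_to_K,
    RCLike.ofReal_eq_complex_ofReal, ← Complex.ofReal_pow, Complex.ofReal_re]

/-- If `D* D ≤ c A` and `D* D ≤ 4`, then `D* D ≤ 4 ^ (1 - α) c ^ α A ^ α`. -/
theorem norm_sq_le_fracPow {A D : 𝓗 →L[ℂ] 𝓗} (hA : 0 ≤ A) {c α : ℝ} (hc : 0 < c) (hα₀ : 0 < α)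
    (hα₁ : α ≤ 1) (hD : ‖D‖ ≤ 2) (h : ∀ x, ‖D x‖ ^ 2 ≤ c * (inner ℂ x (A x)).re) (x : 𝓗) :
    ‖D x‖ ^ 2 ≤ 4 ^ (1 - α) * c ^ α * (inner ℂ x (fracPow A α x)).re := by
  have hB : 0 ≤ star D * D := star_mul_self_nonneg D
  have hB' : 0 ≤ c⁻¹ • (star D * D) := smul_nonneg (by positivity) hB
  have hBA : c⁻¹ • (star D * D) ≤ A := by
    rw [ContinuousLinearMap.le_def, ContinuousLinearMap.isPositive_def']
    refine ⟨(IsSelfAdjoint.of_nonneg hA).sub (IsSelfAdjoint.of_nonneg hB'), fun ψ => ?_⟩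
    rw [ContinuousLinearMap.reApplyInnerSelf_apply, inner_re_symm, sub_apply, smul_apply,
      inner_sub_right, inner_smul_right_eq_smul]
    have h2 := re_inner_star_mul_self D ψ
    change 0 ≤ (inner ℂ ψ (A ψ) - c⁻¹ • inner ℂ ψ ((star D * D) ψ)).re
    rw [Complex.sub_re, Complex.real_smul, Complex.re_ofReal_mul, h2, sub_nonneg,
      inv_mul_eq_div, div_le_iff₀' hc]
    exact h ψ
  have hM : ‖c⁻¹ • (star D * D)‖ ≤ 4 / c := by
    rw [norm_smul, CStarRing.norm_star_mul_self, norm_inv, Real.norm_eq_abs, abs_of_pos hc,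
      inv_mul_eq_div]
    gcongr
    nlinarith [norm_nonneg D]
  have h := re_inner_le_rpow_mul_fracPow hB' hBA hM hα₀ hα₁ x
  rw [smul_apply, inner_smul_right_eq_smul, Complex.real_smul, Complex.re_ofReal_mul,
    re_inner_star_mul_self, inv_mul_eq_div, div_le_iff₀' hc] at h
  refine h.trans (le_of_eq ?_)
  have hpow : c * (4 / c) ^ (1 - α) = 4 ^ (1 - α) * c ^ α := by
    rw [Real.div_rpow (by norm_num) hc.le, Real.rpow_sub hc, Real.rpow_one]
    have : c ^ α ≠ 0 := (Real.rpow_pos_of_pos hc α).ne'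
    field_simp
  rw [← mul_assoc, hpow]

end OperatorInequalities

/-! ### The Laplacian and finite differences -/

section Laplacian

variable {d : ℕ}

theorem star_mul_one_sub_translation (v : Lattice d) :
    star (1 - translation v) * (1 - translation v) =
      (1 - translation v) + (1 - translation (-v)) := by
  have h : translation (-v) * translation v = (1 : L2 d →L[ℂ] L2 d) := by
    rw [← translation_zero, ← neg_add_cancel v]
    ext φ : 1
    rw [mul_apply_eq_comp, translation_translation]
  rw [star_sub, star_one, star_translation, sub_mul, one_mul, mul_sub, mul_one, h]
  abel

theorem negLaplacian_eq_sum_star_mul_self (d : ℕ) : negLaplacian d =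
    ∑ j : Fin d, star (1 - translation (Pi.single j (1 : ℤ))) *
      (1 - translation (Pi.single j (1 : ℤ))) := by
  simp only [star_mul_one_sub_translation]
  rfl

theorem negLaplacian_nonneg (d : ℕ) : 0 ≤ negLaplacian d := by
  rw [negLaplacian_eq_sum_star_mul_self]
  exact Finset.sum_nonneg fun j _ => star_mul_self_nonneg _

theorem re_inner_negLaplacian (φ : L2 d) : (inner ℂ φ (negLaplacian d φ)).re =
    ∑ j : Fin d, ‖φ - translation (Pi.single j (1 : ℤ)) φ‖ ^ 2 := by
  rw [negLaplacian_eq_sum_star_mul_self, sum_apply, inner_sum, Complex.re_sum]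
  refine Finset.sum_congr rfl fun j _ => ?_
  rw [re_inner_star_mul_self]
  rfl

theorem norm_sub_translation_add_le (v w : Lattice d) (φ : L2 d) :
    ‖φ - translation (v + w) φ‖ ≤ ‖φ - translation v φ‖ + ‖φ - translation w φ‖ := by
  have h : φ - translation (v + w) φ =
      (φ - translation v φ) + translation v (φ - translation w φ) := by
    rw [map_sub, translation_translation]; abel
  rw [h, ← norm_translation_apply v (φ - translation w φ)]
  exact norm_add_le _ _

theorem norm_sub_translation_neg (v : Lattice d) (φ : L2 d) :
    ‖φ - translation (-v) φ‖ = ‖φ - translation v φ‖ := by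
  rw [← norm_translation_apply v (φ - translation (-v) φ), map_sub, translation_translation,
    add_neg_cancel, translation_zero, norm_sub_rev]
  rfl

theorem norm_sub_translation_zsmul_le (k : ℤ) (v : Lattice d) (φ : L2 d) :
    ‖φ - translation (k • v) φ‖ ≤ |(k : ℝ)| * ‖φ - translation v φ‖ := by
  have hnat : ∀ n : ℕ, ‖φ - translation (n • v) φ‖ ≤ n * ‖φ - translation v φ‖ := by
    intro n
    induction n with
    | zero => simp [translation_zero]
    | succ n ih =>
      rw [add_smul, one_smul]
      refine (norm_sub_translation_add_le _ _ _).trans ?_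
      push_cast
      linarith
  obtain ⟨n, rfl | rfl⟩ := k.eq_nat_or_neg
  · simpa using hnat n
  · rw [neg_smul, norm_sub_translation_neg]
    simpa using hnat n

theorem norm_sub_translation_le_sum (v : Lattice d) (φ : L2 d) :
    ‖φ - translation v φ‖ ≤
      ∑ j : Fin d, |(v j : ℝ)| * ‖φ - translation (Pi.single j (1 : ℤ)) φ‖ := by
  have h : ∀ s : Finset (Fin d), ‖φ - translation (∑ j ∈ s, v j • Pi.single j (1 : ℤ)) φ‖ ≤
      ∑ j ∈ s, |(v j : ℝ)| * ‖φ - translation (Pi.single j (1 : ℤ)) φ‖ := by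
    intro s
    induction s using Finset.induction_on with
    | empty => simp [translation_zero]
    | insert j s hj ih =>
      rw [Finset.sum_insert hj, Finset.sum_insert hj]
      exact (norm_sub_translation_add_le _ _ _).trans
        (add_le_add (norm_sub_translation_zsmul_le _ _ _) ih)
  have hv : v = ∑ j : Fin d, v j • Pi.single j (1 : ℤ) := by
    conv_lhs => rw [← Finset.univ_sum_single v]
    refine Finset.sum_congr rfl fun j _ => ?_
    rw [← Pi.single_smul]
    simp
  conv_lhs => rw [hv]
  exact h _

theorem norm_sub_translation_sq_le {v : Lattice d} {L : ℝ} (hv : ∀ j, |(v j : ℝ)| ≤ L) (φ : L2 d) :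
    ‖φ - translation v φ‖ ^ 2 ≤ d * L ^ 2 * (inner ℂ φ (negLaplacian d φ)).re := by
  rw [re_inner_negLaplacian]
  calc ‖φ - translation v φ‖ ^ 2
      ≤ (∑ j : Fin d, |(v j : ℝ)| * ‖φ - translation (Pi.single j (1 : ℤ)) φ‖) ^ 2 := by
        gcongr; exact norm_sub_translation_le_sum v φ
    _ ≤ (∑ j : Fin d, |(v j : ℝ)| ^ 2) *
        ∑ j : Fin d, ‖φ - translation (Pi.single j (1 : ℤ)) φ‖ ^ 2 :=
        Finset.sum_mul_sq_le_sq_mul_sq _ _ _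
    _ ≤ _ := by
        gcongr
        calc ∑ j : Fin d, |(v j : ℝ)| ^ 2 ≤ ∑ j : Fin d, L ^ 2 := by
              gcongr with j _; exact hv j
          _ = d * L ^ 2 := by simp

/-- The fractional form controls finite differences over distance `L` up to a factor `L ^ (2 α)`. -/
theorem norm_sub_translation_sq_le_fracLaplacian {α : ℝ} (hα₀ : 0 < α) (hα₁ : α ≤ 1)
    (hd : 0 < d) {v : Lattice d} {L : ℝ} (hL : 0 < L) (hv : ∀ j, |(v j : ℝ)| ≤ L) (φ : L2 d) :
    ‖φ - translation v φ‖ ^ 2 ≤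
      4 ^ (1 - α) * (d * L ^ 2) ^ α * (inner ℂ φ (fracLaplacian d α φ)).re := by
  have hD2 : ‖(1 - translation v : L2 d →L[ℂ] L2 d)‖ ≤ 2 := by
    refine ContinuousLinearMap.opNorm_le_bound _ (by norm_num) fun ψ => ?_
    change ‖ψ - translation v ψ‖ ≤ _
    refine (norm_sub_le _ _).trans ?_
    rw [norm_translation_apply]
    linarith
  exact norm_sq_le_fracPow (negLaplacian_nonneg d) (by positivity) hα₀ hα₁ hD2
    (norm_sub_translation_sq_le hv) φ

end Laplacian

/-! ### Low energy functions avoid typical sites -/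

section Deterministic

variable {d : ℕ}

/-- The box `{-L, …, L} ^ d`. -/
def box (d L : ℕ) : Finset (Lattice d) := Fintype.piFinset fun _ => Finset.Icc (-(L : ℤ)) L

theorem mem_box {L : ℕ} {v : Lattice d} : v ∈ box d L ↔ ∀ j, |v j| ≤ L := by
  simp only [box, Fintype.mem_piFinset, Finset.mem_Icc, abs_le]

theorem card_box (d L : ℕ) : (box d L).card = (2 * L + 1) ^ d := by
  rw [box, Fintype.card_piFinset]
  simp only [Int.card_Icc, Finset.prod_const, Finset.card_univ, Fintype.card_fin]
  congr 1
  omega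

theorem hasSum_potential {ω : Lattice d → ℝ} (φ : (potential ω).domain) :
    HasSum (fun n => ω n * ‖((φ : L2 d) : Lattice d → ℂ) n‖ ^ 2)
      (inner ℂ (φ : L2 d) (potential ω φ)).re := by
  have h := Complex.hasSum_re (lp.hasSum_inner (𝕜 := ℂ) (φ : L2 d) (potential ω φ))
  convert h using 2 with n
  rw [potential_apply, RCLike.inner_apply, mul_assoc, Complex.mul_conj, Complex.normSq_eq_norm_sq,
    ← Complex.ofReal_mul, Complex.ofReal_re]

theorem re_inner_hamiltonian {α lam : ℝ} {ω : Lattice d → ℝ} (φ : (hamiltonian α lam ω).domain) :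
    (inner ℂ (φ : L2 d) (hamiltonian α lam ω φ)).re =
      (inner ℂ (φ : L2 d) (fracLaplacian d α φ)).re +
        lam * (inner ℂ (φ : L2 d) (potential ω ⟨φ, φ.2⟩)).re := by
  rw [hamiltonian_apply, inner_add_right, inner_smul_right, Complex.add_re, Complex.re_ofReal_mul]

theorem re_inner_fracLaplacian_nonneg (α : ℝ) (φ : L2 d) :
    0 ≤ (inner ℂ φ (fracLaplacian d α φ)).re := re_inner_nonneg (fracPow_nonneg _ _) φ

theorem re_inner_potential_nonneg {ω : Lattice d → ℝ} (hω : ∀ n, 0 ≤ ω n)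
    (φ : (potential ω).domain) : 0 ≤ (inner ℂ (φ : L2 d) (potential ω φ)).re :=
  (hasSum_potential φ).nonneg fun n => mul_nonneg (hω n) (sq_nonneg _)

/-- The number of sites of the box `{-L, …, L} ^ d` at which `ω` is at least `c`. -/
def countLarge (c : ℝ) (L : ℕ) (ω : Lattice d → ℝ) : ℝ :=
  ∑ v ∈ box d L, (Set.Ici c).indicator (fun _ => (1 : ℝ)) (ω v)

theorem indicator_mul_norm_sq_le {c t : ℝ} (hc : 0 < c) (ht : 0 ≤ t) (a b : ℂ) :
    (Set.Ici c).indicator (fun _ => (1 : ℝ)) t * ‖a‖ ^ 2 ≤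
      2 * ‖a - b‖ ^ 2 + 2 / c * (t * ‖b‖ ^ 2) := by
  by_cases hct : c ≤ t
  · rw [Set.indicator_of_mem (Set.mem_Ici.mpr hct), one_mul]
    have h1 : ‖b‖ ^ 2 ≤ 1 / c * (t * ‖b‖ ^ 2) := by
      rw [← mul_assoc, one_div_mul_eq_div]
      exact le_mul_of_one_le_left (sq_nonneg _) ((one_le_div hc).mpr hct)
    have h2 : ‖a‖ ≤ ‖a - b‖ + ‖b‖ := by simpa using norm_add_le (a - b) b
    have h3 : ‖a‖ ^ 2 ≤ 2 * ‖a - b‖ ^ 2 + 2 * ‖b‖ ^ 2 := by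
      refine (pow_le_pow_left₀ (norm_nonneg _) h2 2).trans ?_
      nlinarith [sq_nonneg (‖a - b‖ - ‖b‖)]
    rw [show (2 : ℝ) / c = 2 * (1 / c) by ring]
    linarith
  · rw [Set.indicator_of_notMem (by simpa using hct), zero_mul]
    positivity

/-- The mass of `ψ` at a site `n` near which `ω` is often at least `c` is compared with the
potential energy of `ψ` at the neighbouring sites `n + v`, at the cost of the differences
`ψ n - ψ (n + v)`. -/
theorem mul_norm_sq_le_sum_box {c θ : ℝ} (hc : 0 < c) {L : ℕ} {ω : Lattice d → ℝ}
    (hω : ∀ n, 0 ≤ ω n) (ψ : L2 d) {n : Lattice d}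
    (hn : θ * (box d L).card ≤ countLarge c L fun v => ω (v + n)) :
    θ * (box d L).card * ‖(ψ : Lattice d → ℂ) n‖ ^ 2 ≤
      ∑ v ∈ box d L, (2 * ‖((ψ - translation v ψ : L2 d) : Lattice d → ℂ) n‖ ^ 2 +
        2 / c * (ω (n + v) * ‖(ψ : Lattice d → ℂ) (n + v)‖ ^ 2)) := by
  refine (mul_le_mul_of_nonneg_right hn (sq_nonneg _)).trans ?_
  rw [countLarge, Finset.sum_mul]
  refine Finset.sum_le_sum fun v _ => ?_
  rw [lp.coeFn_sub, Pi.sub_apply, translation_apply, add_comm v n]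
  exact indicator_mul_norm_sq_le hc (hω _) _ _

theorem sum_norm_sub_translation_sq_le (hd : 0 < d) {α : ℝ} (hα₀ : 0 < α) (hα₁ : α ≤ 1) {L : ℕ}
    (hL : 0 < L) {v : Lattice d} (hv : v ∈ box d L) (ψ : L2 d) (F : Finset (Lattice d)) :
    ∑ n ∈ F, ‖((ψ - translation v ψ : L2 d) : Lattice d → ℂ) n‖ ^ 2 ≤
      4 ^ (1 - α) * (d * (L : ℝ) ^ 2) ^ α * (inner ℂ ψ (fracLaplacian d α ψ)).re := by
  refine ((summable_norm_sq _).sum_le_tsum F fun _ _ => sq_nonneg _).trans ?_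
  rw [← norm_sq_eq_tsum]
  refine norm_sub_translation_sq_le_fracLaplacian hα₀ hα₁ hd (by exact_mod_cast hL)
    (fun j => ?_) ψ
  exact_mod_cast mem_box.mp hv j

theorem sum_shift_le_of_hasSum {f : Lattice d → ℝ} (hf : ∀ n, 0 ≤ f n) {V : ℝ} (hV : HasSum f V)
    (v : Lattice d) (F : Finset (Lattice d)) : ∑ n ∈ F, f (n + v) ≤ V := by
  have h : HasSum (fun n => f (n + v)) V := (Equiv.addRight v).hasSum_iff.mpr hV
  exact sum_le_hasSum F (fun n _ => hf _) h

theorem sum_norm_sq_le (hd : 0 < d) {α c θ V : ℝ} (hα₀ : 0 < α)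
    (hα₁ : α ≤ 1) (hc : 0 < c) {L : ℕ} (hL : 0 < L) {ω : Lattice d → ℝ}
    (hω : ∀ n, 0 ≤ ω n) (ψ : L2 d) (F : Finset (Lattice d))
    (hF : ∀ n ∈ F, θ * (box d L).card ≤ countLarge c L fun v => ω (v + n))
    (hV : HasSum (fun n => ω n * ‖(ψ : Lattice d → ℂ) n‖ ^ 2) V) :
    θ * ∑ n ∈ F, ‖(ψ : Lattice d → ℂ) n‖ ^ 2 ≤
      2 * (4 ^ (1 - α) * (d * (L : ℝ) ^ 2) ^ α * (inner ℂ ψ (fracLaplacian d α ψ)).re) +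
        2 / c * V := by
  have hB0 : (0 : ℝ) < (box d L).card := by
    rw [card_box]; positivity
  have hdiff := fun v (hv : v ∈ box d L) => sum_norm_sub_translation_sq_le hd hα₀ hα₁ hL hv ψ F
  have hpot := fun v => sum_shift_le_of_hasSum
    (fun n => mul_nonneg (hω n) (sq_nonneg ‖(ψ : Lattice d → ℂ) n‖)) hV v F
  refine le_of_mul_le_mul_left ?_ hB0
  rw [← mul_assoc, mul_comm _ θ, Finset.mul_sum]
  refine (Finset.sum_le_sum fun n hn => mul_norm_sq_le_sum_box hc hω ψ (hF n hn)).trans ?_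
  rw [Finset.sum_comm, ← nsmul_eq_mul]
  refine Finset.sum_le_card_nsmul _ _ _ fun v hv => ?_
  rw [Finset.sum_add_distrib, ← Finset.mul_sum, ← Finset.mul_sum]
  have h1 := hdiff v hv
  have h2 := mul_le_mul_of_nonneg_left (hpot v) (by positivity : 0 ≤ 2 / c)
  linarith

/-- Sites in whose neighbourhood of size `L` the potential is at least `c` on a portion `θ` of the
sites carry only a small part of a function of energy far below `L ^ (-2 α)`.  The differences over
distances up to `L` are controlled by the fractional Laplacian. -/
theorem sum_norm_sq_le_re_inner_hamiltonian (hd : 0 < d) {α lam c θ : ℝ} (hα₀ : 0 < α)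
    (hα₁ : α ≤ 1) (hlam : 0 < lam) (hc : 0 < c) {L : ℕ} (hL : 0 < L) {ω : Lattice d → ℝ}
    (hω : ∀ n, 0 ≤ ω n) (φ : (hamiltonian α lam ω).domain) (F : Finset (Lattice d))
    (hF : ∀ n ∈ F, θ * (box d L).card ≤ countLarge c L fun v => ω (v + n)) :
    θ * ∑ n ∈ F, ‖((φ : L2 d) : Lattice d → ℂ) n‖ ^ 2 ≤
      (2 * 4 ^ (1 - α) * (d : ℝ) ^ α + 2 / (c * lam)) * ((L : ℝ) ^ 2) ^ α *
        (inner ℂ (φ : L2 d) (hamiltonian α lam ω φ)).re := by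
  have h := sum_norm_sq_le hd hα₀ hα₁ hc hL hω φ.1 F hF (hasSum_potential ⟨φ.1, φ.2⟩)
  have hV0 := re_inner_potential_nonneg hω ⟨φ.1, φ.2⟩
  have hK0 := re_inner_fracLaplacian_nonneg α φ.1
  refine h.trans ?_
  rw [re_inner_hamiltonian, Real.mul_rpow (by positivity) (by positivity)]
  generalize (inner ℂ φ.1 (potential ω ⟨φ.1, φ.2⟩)).re = V at *
  generalize (inner ℂ φ.1 (fracLaplacian d α φ.1)).re = K at *
  have hL1 : (1 : ℝ) ≤ L := by exact_mod_cast hL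
  have hℓ1 : 1 ≤ ((L : ℝ) ^ 2) ^ α := Real.one_le_rpow (one_le_pow₀ hL1) hα₀.le
  generalize ((L : ℝ) ^ 2) ^ α = ℓ at *
  have ha0 : 0 ≤ (4 : ℝ) ^ (1 - α) * (d : ℝ) ^ α := by positivity
  have hb0 : 0 ≤ 2 / (c * lam) := by positivity
  have e1 : 2 / c * V = 2 / (c * lam) * (lam * V) := by field_simp
  have e2 : 2 * ((4 : ℝ) ^ (1 - α) * ((d : ℝ) ^ α * ℓ) * K) =
    2 * (4 ^ (1 - α) * (d : ℝ) ^ α) * K * ℓ := by ring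
  rw [e1, e2, mul_assoc 2 _ ((d : ℝ) ^ α)]
  generalize (4 : ℝ) ^ (1 - α) * (d : ℝ) ^ α = a at *
  generalize 2 / (c * lam) = b at *
  have hW : 0 ≤ lam * V := by positivity
  generalize lam * V = W at *
  have t1 : b * W ≤ b * W * ℓ := le_mul_of_one_le_right (by positivity) hℓ1
  have t2 : 0 ≤ b * K * ℓ := by positivity
  have t3 : 0 ≤ a * W * ℓ := by positivity
  have e3 : (2 * a + b) * ℓ * (K + W) =
    2 * a * K * ℓ + b * W * ℓ + b * K * ℓ + 2 * (a * W * ℓ) := by ring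
  rw [e3]
  linarith

end Deterministic

/-! ### Independence, stationarity and mass transport -/

section Probability

variable {d : ℕ}

/-- The product measure `⨂ P₀` on `ℝ ^ (ℤ ^ d)`. -/
abbrev productMeasure (d : ℕ) (P₀ : Measure ℝ) [IsProbabilityMeasure P₀] :
    Measure (Lattice d → ℝ) := Measure.infinitePi fun _ : Lattice d => P₀

variable (P₀ : Measure ℝ) [IsProbabilityMeasure P₀]

theorem measurePreserving_shift (v : Lattice d) :
    MeasurePreserving (fun (ω : Lattice d → ℝ) n => ω (n + v)) (productMeasure d P₀)
      (productMeasure d P₀) :=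
  ⟨by fun_prop, Measure.map_infinitePi_infinitePi_of_inj (P := fun _ : Lattice d => P₀)
    (add_left_injective v)⟩

theorem ae_nonneg_productMeasure (d : ℕ) (hP₀ : P₀ (Set.Iio 0) = 0) :
    ∀ᵐ ω ∂productMeasure d P₀, ∀ n, 0 ≤ ω n := by
  rw [ae_all_iff]
  intro n
  have hmp : MeasurePreserving (Function.eval n) (productMeasure d P₀) P₀ :=
    measurePreserving_eval_infinitePi (fun _ : Lattice d => P₀) n
  have h : ∀ᵐ x ∂P₀, 0 ≤ x := by
    rw [ae_iff]
    simpa [Set.Iio_def] using hP₀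
  exact hmp.quasiMeasurePreserving.ae h

/-- Covariance of the matrix elements of the spectral projections. -/
theorem spectralProjection_apply_shift (α : ℝ) {lam : ℝ} (hlam : lam ≠ 0) (ω : Lattice d → ℝ)
    (E : ℝ) (v m n : Lattice d) :
    (spectralProjection (hamiltonian α lam fun k => ω (k + v)) E (delta n) : Lattice d → ℂ) m =
      (spectralProjection (hamiltonian α lam ω) E (delta (n + v)) : Lattice d → ℂ) (m + v) := by
  have h := spectralProjection_hamiltonian_shift α hlam ω v E (delta (n + v))
  rw [translation_delta, add_sub_cancel_right] at h
  rw [h, translation_apply]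

theorem norm_spectralProjection_shift (α : ℝ) {lam : ℝ} (hlam : lam ≠ 0) (ω : Lattice d → ℝ)
    (E : ℝ) (v : Lattice d) :
    ‖spectralProjection (hamiltonian α lam fun k => ω (k + v)) E (delta 0)‖ =
      ‖spectralProjection (hamiltonian α lam ω) E (delta v)‖ := by
  have h := spectralProjection_hamiltonian_shift α hlam ω v E (delta v)
  rw [translation_delta, sub_self] at h
  rw [h, norm_translation_apply]

theorem spectralProjection_apply_symm (α lam : ℝ) (ω : Lattice d → ℝ) (E : ℝ) (m n : Lattice d) :
    ‖(spectralProjection (hamiltonian α lam ω) E (delta n) : Lattice d → ℂ) m‖ =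
      ‖(spectralProjection (hamiltonian α lam ω) E (delta m) : Lattice d → ℂ) n‖ := by
  rw [← inner_delta_left, ← inner_spectralProjection_left, ← inner_conj_symm, inner_delta_left,
    RCLike.norm_conj]

theorem measurable_norm_spectralProjection_sq (α : ℝ) {lam : ℝ} (hlam : lam ≠ 0) (E : ℝ)
    (x : L2 d) : Measurable fun ω : Lattice d → ℝ =>
      ‖spectralProjection (hamiltonian α lam ω) E x‖ ^ 2 := by
  simp only [← re_inner_spectralProjection_self]
  exact Complex.measurable_re.comp (measurable_inner_spectralProjection α hlam E x x)

theorem measurable_spectralProjection_apply (α : ℝ) {lam : ℝ} (hlam : lam ≠ 0) (E : ℝ)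
    (x : L2 d) (n : Lattice d) : Measurable fun ω : Lattice d → ℝ =>
      (spectralProjection (hamiltonian α lam ω) E x : Lattice d → ℂ) n := by
  simp only [← inner_delta_left]
  exact measurable_inner_spectralProjection α hlam E x _

theorem ids_eq_integral (α lam E : ℝ) : ids d α lam P₀ E =
    ∫ ω, ‖spectralProjection (hamiltonian α lam ω) E (delta 0)‖ ^ 2 ∂productMeasure d P₀ := by
  simp only [ids, re_inner_spectralProjection_self]

theorem integrable_norm_spectralProjection_sq (α : ℝ) {lam : ℝ} (hlam : lam ≠ 0) (E : ℝ)
    (x : L2 d) : Integrable (fun ω : Lattice d → ℝ =>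
      ‖spectralProjection (hamiltonian α lam ω) E x‖ ^ 2) (productMeasure d P₀) := by
  refine Integrable.of_bound
    (measurable_norm_spectralProjection_sq α hlam E x).aestronglyMeasurable (‖x‖ ^ 2)
    (Eventually.of_forall fun ω => ?_)
  rw [norm_pow, norm_norm]
  gcongr
  exact norm_spectralProjection_apply_le _ _ _

theorem integral_norm_spectralProjection_sq (α : ℝ) {lam : ℝ} (hlam : lam ≠ 0) (E : ℝ)
    (v : Lattice d) :
    ∫ ω, ‖spectralProjection (hamiltonian α lam ω) E (delta v)‖ ^ 2 ∂productMeasure d P₀ =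
      ids d α lam P₀ E := by
  have hm := measurable_norm_spectralProjection_sq α hlam E (delta (0 : Lattice d))
  have h := (measurePreserving_shift P₀ v)
  rw [ids_eq_integral]
  conv_rhs => rw [← h.map_eq]
  rw [integral_map h.aemeasurable hm.aestronglyMeasurable]
  simp only [norm_spectralProjection_shift α hlam]

/-- The mass transport principle: summing over `m` the mass at `m` of the spectral projection of
`δ₀`, on the event that `ω` seen from `m` lies in `S`, is on average the mass
`∑ m, |⟪δ₀, Q δ_m⟫| ^ 2` restricted to the event that `ω` itself lies in `S`, which is at most the
probability of `S`. -/
theorem lintegral_tsum_indicator_shift (α : ℝ) {lam : ℝ} (hlam : lam ≠ 0) (E : ℝ)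
    {S : Set (Lattice d → ℝ)} (hS : MeasurableSet S) :
    ∫⁻ ω, ∑' m, S.indicator (fun _ => ‖(spectralProjection (hamiltonian α lam ω) E (delta 0) :
        Lattice d → ℂ) m‖ₑ ^ 2) (fun k => ω (k + m)) ∂productMeasure d P₀ ≤
      productMeasure d P₀ S := by
  classical
  set g : Lattice d → (Lattice d → ℝ) → ℝ≥0∞ := fun m ω =>
    S.indicator (fun ω' => ‖(spectralProjection (hamiltonian α lam ω') E (delta 0) :
        Lattice d → ℂ) (-m)‖ₑ ^ 2) ω with hg
  have hgm : ∀ m, Measurable (g m) := fun m =>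
    ((measurable_spectralProjection_apply α hlam E _ _).enorm.pow_const 2).indicator hS
  have hfun : ∀ (m : Lattice d) (ω : Lattice d → ℝ),
      S.indicator (fun _ => ‖(spectralProjection (hamiltonian α lam ω) E (delta 0) :
        Lattice d → ℂ) m‖ₑ ^ 2) (fun k => ω (k + m)) = g m fun k => ω (k + m) := by
    intro m ω
    simp only [hg, Set.indicator_apply]
    congr 2
    rw [← ofReal_norm, ← ofReal_norm, spectralProjection_apply_symm α lam _ E (-m) 0,
      spectralProjection_apply_shift α hlam ω E m 0 (-m), neg_add_cancel, zero_add]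
  simp only [hfun]
  have hgm' : ∀ m, AEMeasurable (fun ω : Lattice d → ℝ => g m fun k => ω (k + m))
      (productMeasure d P₀) := fun m =>
    ((hgm m).comp (measurePreserving_shift P₀ m).measurable).aemeasurable
  rw [lintegral_tsum hgm']
  have hshift : ∀ m, ∫⁻ ω, g m (fun k => ω (k + m)) ∂productMeasure d P₀ =
      ∫⁻ ω, g m ω ∂productMeasure d P₀ := fun m =>
    (measurePreserving_shift P₀ m).lintegral_comp (hgm m)
  simp only [hshift]
  rw [← lintegral_tsum fun m => (hgm m).aemeasurable, ← lintegral_indicator_one hS]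
  refine lintegral_mono fun ω => ?_
  by_cases hω : ω ∈ S
  · simp only [hg, Set.indicator_of_mem hω]
    refine ((Equiv.neg (Lattice d)).tsum_eq (fun m => ‖(spectralProjection (hamiltonian α lam ω) E
      (delta 0) : Lattice d → ℂ) m‖ₑ ^ 2)).le.trans ?_
    have h1 : ∀ z : ℂ, ‖z‖ₑ ^ 2 = ENNReal.ofReal (‖z‖ ^ 2) := fun z => by
      rw [ENNReal.ofReal_pow (norm_nonneg _), ofReal_norm]
    simp only [h1]
    rw [← ENNReal.ofReal_tsum_of_nonneg (fun _ => sq_nonneg _) (summable_norm_sq _),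
      ← norm_sq_eq_tsum, Pi.one_apply, ENNReal.ofReal_le_one]
    have h2 := norm_spectralProjection_apply_le (hamiltonian α lam ω) E (delta 0)
    rw [norm_delta] at h2
    exact pow_le_one₀ (norm_nonneg _) h2
  · simp [hg, Set.indicator_of_notMem hω]

theorem measurable_countLarge (c : ℝ) (L : ℕ) : Measurable (countLarge (d := d) c L) := by
  unfold countLarge
  refine Finset.measurable_sum _ fun v _ => ?_
  exact (measurable_const.indicator measurableSet_Ici).comp (measurable_pi_apply v)

/-- A Chernoff bound: it is exponentially unlikely in the volume that `ω` is at least `c` only on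
a small portion of a box. -/
theorem exists_measure_countLarge_le {c : ℝ} (hc : 0 < P₀ (Set.Ici c)) :
    ∃ θ > 0, ∀ d L : ℕ, (productMeasure d P₀).real
      {ω | countLarge c L ω ≤ θ * (box d L).card} ≤ Real.exp (-(θ * (box d L).card)) := by
  set X : ℝ → ℝ := (Set.Ici c).indicator (fun _ => (1 : ℝ)) with hX
  have hXm : Measurable X := measurable_const.indicator measurableSet_Ici
  have hX01 : ∀ x, X x = 0 ∨ X x = 1 := by
    intro x
    by_cases hx : x ∈ Set.Ici c
    · right; exact Set.indicator_of_mem hx _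
    · left; exact Set.indicator_of_notMem hx _
  have hexp1 : ∀ x, Real.exp (-1 * X x) ≤ 1 := by
    intro x
    rw [Real.exp_le_one_iff]
    rcases hX01 x with h | h <;> rw [h] <;> norm_num
  set q : ℝ := ∫ x, Real.exp (-1 * X x) ∂P₀ with hq
  have hint : Integrable (fun x => Real.exp (-1 * X x)) P₀ := by
    refine Integrable.of_bound (by fun_prop) 1 (Eventually.of_forall fun x => ?_)
    rw [Real.norm_eq_abs, abs_of_pos (Real.exp_pos _)]
    exact hexp1 x
  have hq0 : 0 < q := integral_exp_pos hint
  have hq1 : q < 1 := by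
    have h1 : 0 < ∫ x, (1 - Real.exp (-1 * X x)) ∂P₀ := by
      rw [integral_pos_iff_support_of_nonneg (fun x => sub_nonneg.mpr (hexp1 x))
        ((integrable_const _).sub hint)]
      refine lt_of_lt_of_le hc (measure_mono fun x hx => ?_)
      have hx1 : X x = 1 := Set.indicator_of_mem hx _
      have hlt : Real.exp (-1 * X x) < 1 := by
        rw [hx1, Real.exp_lt_one_iff]
        norm_num
      exact (sub_pos.mpr hlt).ne'
    rw [integral_sub (integrable_const _) hint, ← hq] at h1
    simpa using h1
  -- The Chernoff bound reads `exp (θ * B) * q ^ B` for a box with `B` sites, and `q ^ B` is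
  -- `exp (-(2 * θ) * B)` for this choice of `θ`.
  refine ⟨-(Real.log q) / 2, by have := Real.log_neg hq0 hq1; linarith, fun d L => ?_⟩
  set B : ℝ := ((box d L).card : ℝ) with hB
  have hindep := ProbabilityTheory.iIndepFun_infinitePi (P := fun _ : Lattice d => P₀)
    (X := fun _ => X) (fun _ => hXm)
  have hmgf := hindep.mgf_sum (t := -1) (fun v => hXm.comp (measurable_pi_apply v)) (box d L)
  have hone : ∀ v : Lattice d, ProbabilityTheory.mgf (fun ω : Lattice d → ℝ => X (ω v))
      (productMeasure d P₀) (-1) = q := by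
    intro v
    have hmp : MeasurePreserving (Function.eval v) (productMeasure d P₀) P₀ :=
      measurePreserving_eval_infinitePi (fun _ : Lattice d => P₀) v
    rw [ProbabilityTheory.mgf, hq]
    conv_rhs => rw [← hmp.map_eq]
    rw [integral_map hmp.aemeasurable (by fun_prop)]
  simp only [hone, Finset.prod_const] at hmgf
  have hsumeq : (∑ v ∈ box d L, fun ω : Lattice d → ℝ => X (ω v)) = countLarge c L := by
    funext ω
    rw [Finset.sum_apply]
    rfl
  rw [hsumeq] at hmgf
  have hcint : Integrable (fun ω => Real.exp (-1 * countLarge c L ω)) (productMeasure d P₀) := by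
    have := measurable_countLarge (d := d) c L
    refine Integrable.of_bound (by fun_prop) 1 (Eventually.of_forall fun ω => ?_)
    rw [Real.norm_eq_abs, abs_of_pos (Real.exp_pos _), Real.exp_le_one_iff]
    have : 0 ≤ countLarge c L ω := Finset.sum_nonneg fun v _ => by
      rcases hX01 (ω v) with h | h <;> rw [hX] at h <;> rw [h]
      exact zero_le_one
    linarith
  have h := ProbabilityTheory.measure_le_le_exp_mul_mgf (-(Real.log q) / 2 * B)
    (by norm_num : (-1 : ℝ) ≤ 0) hcint
  refine h.trans (le_of_eq ?_)
  rw [hmgf, ← Real.exp_log hq0, ← Real.exp_nat_mul, ← Real.exp_add, Real.log_exp, ← hB]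
  congr 1
  ring

end Probability

/-! ### Upper bound on the integrated density of states -/

section UpperBound

variable {d : ℕ}

/-- If `E` is a small multiple of `L ^ (-2 α)`, at least half of the mass of a function in the
spectral subspace sits at the sites `m` in whose `L`-neighbourhood the potential is at least `c` on
at most a portion `θ` of the sites. -/
theorem half_enorm_sq_le_tsum_indicator (hd : 0 < d) {α lam c θ : ℝ} (hα₀ : 0 < α)
    (hα₁ : α ≤ 1) (hlam : 0 < lam) (hc : 0 < c) (hθ : 0 < θ) {L : ℕ} (hL : 0 < L) {E : ℝ}
    (hE : (2 * 4 ^ (1 - α) * (d : ℝ) ^ α + 2 / (c * lam)) * ((L : ℝ) ^ 2) ^ α * E ≤ θ / 2)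
    {ω : Lattice d → ℝ} (hω : ∀ n, 0 ≤ ω n) (x : L2 d) :
    ENNReal.ofReal (‖spectralProjection (hamiltonian α lam ω) E x‖ ^ 2) ≤
      2 * ∑' m, {ω' | countLarge c L ω' ≤ θ * (box d L).card}.indicator
        (fun _ => ‖(spectralProjection (hamiltonian α lam ω) E x : Lattice d → ℂ) m‖ₑ ^ 2)
        (fun k => ω (k + m)) := by
  classical
  set S : Set (Lattice d → ℝ) := {ω' | countLarge c L ω' ≤ θ * (box d L).card} with hS
  set K : ℝ := (2 * 4 ^ (1 - α) * (d : ℝ) ^ α + 2 / (c * lam)) * ((L : ℝ) ^ 2) ^ α with hK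
  set ψ := spectralProjection (hamiltonian α lam ω) E x with hψ
  have hL0 : (0 : ℝ) < L := by exact_mod_cast hL
  have hK0 : 0 < K := by positivity
  set G : Set (Lattice d) := {m | (fun k => ω (k + m)) ∉ S} with hG
  have hgood : ∀ F : Finset (Lattice d), (∀ n ∈ F, n ∈ G) →
      ∑ n ∈ F, ‖(ψ : Lattice d → ℂ) n‖ ^ 2 ≤ ‖ψ‖ ^ 2 / 2 := by
    intro F hF
    have hcont : Continuous fun φ : L2 d =>
        K⁻¹ * (θ * ∑ n ∈ F, ‖(φ : Lattice d → ℂ) n‖ ^ 2) := by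
      simp only [← inner_delta_left]
      fun_prop
    have h := (isSelfAdjointOp_hamiltonian α hlam.ne' ω).apply_spectralProjection_le E hcont
      (fun φ => ?_) x
    · rw [inv_mul_le_iff₀ hK0, ← hψ] at h
      have h2 : θ * ∑ n ∈ F, ‖(ψ : Lattice d → ℂ) n‖ ^ 2 ≤ θ * (‖ψ‖ ^ 2 / 2) := by
        refine h.trans ?_
        rw [← mul_assoc]
        have := mul_le_mul_of_nonneg_right hE (sq_nonneg ‖ψ‖)
        linarith
      exact le_of_mul_le_mul_left h2 hθ
    · rw [inv_mul_le_iff₀ hK0]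
      refine sum_norm_sq_le_re_inner_hamiltonian hd hα₀ hα₁ hlam hc hL hω φ F fun n hn => ?_
      have := hF n hn
      simp only [hG, hS, Set.mem_ofPred_eq, not_le] at this
      exact this.le
  have hsumm := summable_norm_sq ψ
  have hGsum : ∑' n, G.indicator (fun n => ‖(ψ : Lattice d → ℂ) n‖ ^ 2) n ≤ ‖ψ‖ ^ 2 / 2 := by
    refine (hsumm.indicator G).tsum_le_of_sum_le fun F => ?_
    rw [Finset.sum_indicator_eq_sum_filter]
    exact hgood _ fun n hn => (Finset.mem_filter.mp hn).2
  have hsplit : ‖ψ‖ ^ 2 = ∑' n, G.indicator (fun n => ‖(ψ : Lattice d → ℂ) n‖ ^ 2) n +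
      ∑' n, Gᶜ.indicator (fun n => ‖(ψ : Lattice d → ℂ) n‖ ^ 2) n := by
    rw [norm_sq_eq_tsum, ← (hsumm.indicator G).tsum_add (hsumm.indicator Gᶜ)]
    refine tsum_congr fun n => ?_
    have := Set.indicator_self_add_compl_apply G (fun n => ‖(ψ : Lattice d → ℂ) n‖ ^ 2) n
    exact this.symm
  have hbad : ‖ψ‖ ^ 2 ≤ 2 * ∑' n, Gᶜ.indicator (fun n => ‖(ψ : Lattice d → ℂ) n‖ ^ 2) n := by
    linarith
  refine (ENNReal.ofReal_le_ofReal hbad).trans ?_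
  rw [ENNReal.ofReal_mul zero_le_two, ENNReal.ofReal_ofNat,
    ENNReal.ofReal_tsum_of_nonneg (fun n => Set.indicator_nonneg (fun _ _ => sq_nonneg _) n)
      (hsumm.indicator _)]
  refine mul_le_mul_right (ENNReal.tsum_le_tsum fun n => ?_) 2
  by_cases hn : (fun k => ω (k + n)) ∈ S
  · have hn' : n ∈ Gᶜ := by simpa [hG] using hn
    rw [Set.indicator_of_mem hn', Set.indicator_of_mem hn, ENNReal.ofReal_pow (norm_nonneg _),
      ofReal_norm]
  · have hn' : n ∉ Gᶜ := by simpa [hG] using hn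
    rw [Set.indicator_of_notMem hn']
    simp

/-- The mass of the spectral projection of `δ₀` is carried by atypical sites, and by mass transport
its expectation is bounded by the probability that the origin is atypical. -/
theorem ids_le_of_mul_le (P₀ : Measure ℝ) [IsProbabilityMeasure P₀] (hP₀ : P₀ (Set.Iio 0) = 0)
    (hd : 0 < d) {α lam c θ : ℝ} (hα₀ : 0 < α)
    (hα₁ : α ≤ 1) (hlam : 0 < lam) (hc : 0 < c) (hθ : 0 < θ) {L : ℕ} (hL : 0 < L) {E : ℝ}
    (hE : (2 * 4 ^ (1 - α) * (d : ℝ) ^ α + 2 / (c * lam)) * ((L : ℝ) ^ 2) ^ α * E ≤ θ / 2) :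
    ids d α lam P₀ E ≤ 2 * (productMeasure d P₀).real
      {ω | countLarge c L ω ≤ θ * (box d L).card} := by
  set S : Set (Lattice d → ℝ) := {ω' | countLarge c L ω' ≤ θ * (box d L).card} with hS
  have hSm : MeasurableSet S := measurableSet_le (measurable_countLarge c L) measurable_const
  have hω := ae_nonneg_productMeasure P₀ d hP₀
  rw [ids_eq_integral, integral_eq_lintegral_of_nonneg_ae
    (Eventually.of_forall fun _ => sq_nonneg _)
    (measurable_norm_spectralProjection_sq α hlam.ne' E _).aestronglyMeasurable]
  have h : ∫⁻ ω, ENNReal.ofReal (‖spectralProjection (hamiltonian α lam ω) E (delta 0)‖ ^ 2)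
      ∂productMeasure d P₀ ≤ 2 * productMeasure d P₀ S := by
    refine (lintegral_mono_ae (hω.mono fun ω hω' =>
      half_enorm_sq_le_tsum_indicator hd hα₀ hα₁ hlam hc hθ hL hE hω' (delta 0))).trans ?_
    rw [lintegral_const_mul' _ _ (by simp)]
    exact mul_le_mul_right (lintegral_tsum_indicator_shift P₀ α hlam.ne' E hSm) 2
  refine (ENNReal.toReal_mono (ENNReal.mul_ne_top (by simp) (measure_ne_top _ _)) h).trans ?_
  rw [ENNReal.toReal_mul]
  rfl

end UpperBound

/-! ### Lower bound on the integrated density of states -/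

section LowerBound

variable {d : ℕ}

theorem mem_box_iff_norm_le {L : ℕ} {n : Lattice d} : n ∈ box d L ↔ ‖n‖ ≤ L := by
  rw [mem_box, pi_norm_le_iff_of_nonneg (Nat.cast_nonneg L)]
  refine forall_congr' fun j => ?_
  rw [Int.norm_eq_abs]
  exact_mod_cast Iff.rfl

/-- The pyramid `n ↦ max (2 M - ‖n‖) 0`, with the supremum norm on `ℤ ^ d`. -/
def pyramid (d M : ℕ) : L2 d :=
  ⟨fun n => ((max (2 * (M : ℝ) - ‖n‖) 0 : ℝ) : ℂ), by
    refine memℓp_gen (summable_of_ne_finset_zero (s := box d (2 * M)) fun n hn => ?_)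
    rw [mem_box_iff_norm_le] at hn
    push Not at hn
    push_cast at hn
    rw [max_eq_right (by linarith)]
    simp⟩

theorem pyramid_apply (M : ℕ) (n : Lattice d) :
    (pyramid d M : Lattice d → ℂ) n = ((max (2 * (M : ℝ) - ‖n‖) 0 : ℝ) : ℂ) := rfl

theorem pyramid_apply_of_notMem {M : ℕ} {n : Lattice d} (hn : n ∉ box d (2 * M)) :
    (pyramid d M : Lattice d → ℂ) n = 0 := by
  rw [mem_box_iff_norm_le] at hn
  push Not at hn
  push_cast at hn
  rw [pyramid_apply, max_eq_right (by linarith), Complex.ofReal_zero]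

theorem norm_pyramid_sq (M : ℕ) : ‖pyramid d M‖ ^ 2 =
    ∑ n ∈ box d (2 * M), ‖(pyramid d M : Lattice d → ℂ) n‖ ^ 2 := by
  rw [norm_sq_eq_tsum]
  exact tsum_eq_sum fun n hn => by rw [pyramid_apply_of_notMem hn]; simp

theorem le_norm_pyramid_sq (M : ℕ) :
    (M : ℝ) ^ 2 * (2 * M + 1) ^ d ≤ ‖pyramid d M‖ ^ 2 := by
  rw [norm_sq_eq_tsum]
  refine le_trans ?_ ((summable_norm_sq _).sum_le_tsum (box d M) fun _ _ => sq_nonneg _)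
  have h : ∀ n ∈ box d M, (M : ℝ) ^ 2 ≤ ‖(pyramid d M : Lattice d → ℂ) n‖ ^ 2 := by
    intro n hn
    rw [mem_box_iff_norm_le] at hn
    rw [pyramid_apply, Complex.norm_real, Real.norm_eq_abs, sq_abs]
    have : (M : ℝ) ≤ max (2 * (M : ℝ) - ‖n‖) 0 := le_max_of_le_left (by linarith)
    gcongr
  refine le_trans (le_of_eq ?_) (Finset.card_nsmul_le_sum _ _ _ h)
  rw [card_box, nsmul_eq_mul]
  push_cast
  ring

theorem norm_pyramid_sub_translation_sq_le (M : ℕ) (j : Fin d) :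
    ‖pyramid d M - translation (Pi.single j (1 : ℤ)) (pyramid d M)‖ ^ 2 ≤ (4 * M + 1) ^ d := by
  have he : ‖(Pi.single j (1 : ℤ) : Lattice d)‖ = 1 := by
    rw [Pi.norm_single]; simp
  have hval : ∀ n, ‖((pyramid d M - translation (Pi.single j (1 : ℤ)) (pyramid d M) : L2 d) :
      Lattice d → ℂ) n‖ =
      |max (2 * (M : ℝ) - ‖n‖) 0 - max (2 * (M : ℝ) - ‖n + Pi.single j (1 : ℤ)‖) 0| := by
    intro n
    rw [lp.coeFn_sub, Pi.sub_apply, translation_apply, pyramid_apply, pyramid_apply,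
      ← Complex.ofReal_sub, Complex.norm_real, Real.norm_eq_abs]
  have hlip : ∀ n : Lattice d, |‖n‖ - ‖n + Pi.single j (1 : ℤ)‖| ≤ 1 := by
    intro n
    refine (abs_norm_sub_norm_le _ _).trans ?_
    rw [sub_add_cancel_left, norm_neg, he]
  have hzero : ∀ n ∉ box d (2 * M),
      ‖((pyramid d M - translation (Pi.single j (1 : ℤ)) (pyramid d M) : L2 d) :
        Lattice d → ℂ) n‖ ^ 2 = 0 := by
    intro n hn
    have h1 : ((2 * M + 1 : ℕ) : ℝ) ≤ ‖n‖ := by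
      by_contra hcon
      push Not at hcon
      apply hn
      rw [mem_box]
      intro i
      have h2 := (norm_le_pi_norm n i).trans_lt hcon
      rw [Int.norm_eq_abs] at h2
      have h3 : |n i| < (2 * M + 1 : ℕ) := by exact_mod_cast h2
      push_cast at h3 ⊢
      omega
    push_cast at h1
    have h2 := abs_le.mp (hlip n)
    rw [hval, max_eq_right (by linarith), max_eq_right (by linarith)]
    simp
  rw [norm_sq_eq_tsum, tsum_eq_sum hzero]
  have h : ∀ n ∈ box d (2 * M),
      ‖((pyramid d M - translation (Pi.single j (1 : ℤ)) (pyramid d M) : L2 d) :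
        Lattice d → ℂ) n‖ ^ 2 ≤ 1 := by
    intro n _
    rw [hval]
    refine pow_le_one₀ (abs_nonneg _) ((abs_max_sub_max_le_abs _ _ _).trans ?_)
    rw [sub_sub_sub_cancel_left, abs_sub_comm]
    exact hlip n
  refine (Finset.sum_le_card_nsmul _ _ _ h).trans (le_of_eq ?_)
  rw [card_box, nsmul_eq_mul]
  push_cast
  ring

theorem re_inner_negLaplacian_pyramid_le {M : ℕ} (hM : 0 < M) :
    (inner ℂ (pyramid d M) (negLaplacian d (pyramid d M))).re ≤
      d * 2 ^ d / (M : ℝ) ^ 2 * ‖pyramid d M‖ ^ 2 := by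
  have hM0 : (0 : ℝ) < M := by exact_mod_cast hM
  rw [re_inner_negLaplacian]
  refine (Finset.sum_le_card_nsmul _ _ _ fun j _ => norm_pyramid_sub_translation_sq_le M j).trans ?_
  rw [Finset.card_univ, Fintype.card_fin, nsmul_eq_mul]
  have h1 : (4 * (M : ℝ) + 1) ^ d ≤ 2 ^ d * (2 * M + 1) ^ d := by
    rw [← mul_pow]
    gcongr
    linarith
  have h2 := le_norm_pyramid_sq (d := d) M
  calc (d : ℝ) * (4 * M + 1) ^ d ≤ d * (2 ^ d * (2 * M + 1) ^ d) := by gcongr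
    _ = d * 2 ^ d / (M : ℝ) ^ 2 * ((M : ℝ) ^ 2 * (2 * M + 1) ^ d) := by field_simp
    _ ≤ _ := by gcongr

theorem pyramid_mem_domain (α lam : ℝ) (ω : Lattice d → ℝ) (M : ℕ) :
    pyramid d M ∈ (hamiltonian α lam ω).domain := by
  rw [mem_hamiltonian_domain]
  refine memℓp_gen (summable_of_ne_finset_zero (s := box d (2 * M)) fun n hn => ?_)
  rw [pyramid_apply_of_notMem hn]
  simp

theorem re_inner_hamiltonian_pyramid_le {α lam η : ℝ} (hα₀ : 0 < α) (hα₁ : α ≤ 1) (hd : 0 < d)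
    (hlam : 0 < lam) {ω : Lattice d → ℝ} {M : ℕ} (hM : 0 < M)
    (hη : ∀ n ∈ box d (2 * M), ω n ≤ η) :
    (inner ℂ (pyramid d M) (hamiltonian α lam ω ⟨_, pyramid_mem_domain α lam ω M⟩)).re ≤
      ((d * 2 ^ d / (M : ℝ) ^ 2) ^ α + lam * η) * ‖pyramid d M‖ ^ 2 := by
  have hM0 : (0 : ℝ) < M := by exact_mod_cast hM
  have h1 : (inner ℂ (pyramid d M) (fracLaplacian d α (pyramid d M))).re ≤ _ :=
    re_inner_fracPow_le (negLaplacian_nonneg d) (by positivity) hα₀ hα₁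
    (re_inner_negLaplacian_pyramid_le (d := d) hM)
  have h2 : (inner ℂ (pyramid d M)
      (potential ω ⟨_, pyramid_mem_domain α lam ω M⟩)).re ≤ η * ‖pyramid d M‖ ^ 2 := by
    rw [← (hasSum_potential (ω := ω) ⟨_, pyramid_mem_domain α lam ω M⟩).tsum_eq, norm_pyramid_sq,
      Finset.mul_sum, tsum_eq_sum (s := box d (2 * M))]
    · refine Finset.sum_le_sum fun n hn => ?_
      exact mul_le_mul_of_nonneg_right (hη n hn) (sq_nonneg _)
    · intro n hn
      simp only
      rw [pyramid_apply_of_notMem hn]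
      simp
  have h3 := re_inner_hamiltonian (α := α) (lam := lam) (ω := ω) ⟨_, pyramid_mem_domain α lam ω M⟩
  rw [h3, add_mul, mul_assoc]
  exact add_le_add h1 (mul_le_mul_of_nonneg_left h2 hlam.le)

/-- If the potential is small on a large box, the spectral subspace has total weight at least
`1 / 2` there: the pyramid has energy at most `E / 2`, so by Chebyshev half of its mass lies in the
spectral subspace. -/
theorem half_le_sum_norm_spectralProjection_sq {α lam η E : ℝ} (hα₀ : 0 < α) (hα₁ : α ≤ 1)
    (hd : 0 < d) (hlam : 0 < lam) {ω : Lattice d → ℝ} (hω : ∀ n, 0 ≤ ω n) {M : ℕ} (hM : 0 < M)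
    (hη : ∀ n ∈ box d (2 * M), ω n ≤ η) (hE : 0 < E)
    (hME : (d * 2 ^ d / (M : ℝ) ^ 2) ^ α + lam * η ≤ E / 2) :
    1 / 2 ≤ ∑ n ∈ box d (2 * M), ‖spectralProjection (hamiltonian α lam ω) E (delta n)‖ ^ 2 := by
  set φ := pyramid d M with hφ
  set Q := spectralProjection (hamiltonian α lam ω) E with hQ
  have hM0 : (0 : ℝ) < M := by exact_mod_cast hM
  have hφ0 : 0 < ‖φ‖ ^ 2 := lt_of_lt_of_le (by positivity) (le_norm_pyramid_sq M)
  have h1 := (isSelfAdjointOp_hamiltonian α hlam.ne' ω).mul_norm_sub_spectralProjection_sq_le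
    (fun ψ => by
      rw [re_inner_hamiltonian]
      exact add_nonneg (re_inner_fracLaplacian_nonneg α ψ.1)
        (mul_nonneg hlam.le (re_inner_potential_nonneg hω ⟨ψ.1, ψ.2⟩)))
    E ⟨φ, pyramid_mem_domain α lam ω M⟩
  have h2 := h1.trans (re_inner_hamiltonian_pyramid_le hα₀ hα₁ hd hlam hM hη)
  have h3 : ‖φ - Q φ‖ ^ 2 ≤ ‖φ‖ ^ 2 / 2 := by
    have h4 := h2.trans (mul_le_mul_of_nonneg_right hME hφ0.le)
    refine le_of_mul_le_mul_left (h4.trans (le_of_eq ?_)) hE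
    ring
  have h5 : ‖φ‖ ^ 2 = ‖Q φ‖ ^ 2 + ‖φ - Q φ‖ ^ 2 := by
    rw [← re_inner_spectralProjection_self]
    have h6 := norm_sub_sq (𝕜 := ℂ) φ (Q φ)
    have h7 : RCLike.re (inner ℂ φ (Q φ)) = ‖Q φ‖ ^ 2 := re_inner_spectralProjection_self _ _ _
    have h8 : (inner ℂ φ (Q φ)).re = ‖Q φ‖ ^ 2 := re_inner_spectralProjection_self _ _ _
    rw [h7] at h6
    rw [h8]
    linarith
  have hexp : φ = ∑ n ∈ box d (2 * M), (φ : Lattice d → ℂ) n • delta n := by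
    ext m
    rw [lp.coeFn_sum, Finset.sum_apply]
    simp only [lp.coeFn_smul, Pi.smul_apply, smul_eq_mul, delta_apply, mul_ite, mul_one, mul_zero]
    rw [Finset.sum_ite_eq]
    split_ifs with hm
    · rfl
    · exact pyramid_apply_of_notMem hm
  have h9 : ‖Q φ‖ ^ 2 ≤ ‖φ‖ ^ 2 * ∑ n ∈ box d (2 * M), ‖Q (delta n)‖ ^ 2 := by
    have h10 : ‖Q φ‖ ≤ ∑ n ∈ box d (2 * M), ‖(φ : Lattice d → ℂ) n‖ * ‖Q (delta n)‖ := by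
      conv_lhs => rw [hexp]
      rw [map_sum]
      refine (norm_sum_le _ _).trans (le_of_eq (Finset.sum_congr rfl fun n _ => ?_))
      rw [map_smul, norm_smul]
    refine (pow_le_pow_left₀ (norm_nonneg _) h10 2).trans ?_
    refine (Finset.sum_mul_sq_le_sq_mul_sq _ _ _).trans (le_of_eq ?_)
    rw [hφ, ← norm_pyramid_sq]
  have h11 : ‖φ‖ ^ 2 * (1 / 2) ≤ ‖φ‖ ^ 2 * ∑ n ∈ box d (2 * M), ‖Q (delta n)‖ ^ 2 := by linarith
  exact le_of_mul_le_mul_left h11 hφ0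

/-- By independence, the potential is below `η` on a box of side `4 M + 1` with probability the
power of `P₀ [0, η)` in the numerator; on this event `half_le_sum_norm_spectralProjection_sq`
applies, and all sites of the box contribute equally to the expectation of the sum. -/
theorem le_ids_of_le (P₀ : Measure ℝ) [IsProbabilityMeasure P₀] (hP₀ : P₀ (Set.Iio 0) = 0)
    {α lam η E : ℝ} (hα₀ : 0 < α) (hα₁ : α ≤ 1) (hd : 0 < d) (hlam : 0 < lam) {M : ℕ} (hM : 0 < M)
    (hE : 0 < E) (hME : (d * 2 ^ d / (M : ℝ) ^ 2) ^ α + lam * η ≤ E / 2) :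
    P₀.real (Set.Ico 0 η) ^ (box d (2 * M)).card / (2 * (box d (2 * M)).card) ≤
      ids d α lam P₀ E := by
  set B := box d (2 * M) with hB
  have hB0 : (0 : ℝ) < B.card := by
    rw [hB, card_box]; positivity
  set S : Set (Lattice d → ℝ) := Set.pi B fun _ => Set.Ico 0 η with hS
  have hSm : MeasurableSet S := MeasurableSet.pi B.countable_toSet fun _ _ => measurableSet_Ico
  have hSP : (productMeasure d P₀).real S = P₀.real (Set.Ico 0 η) ^ B.card := by
    rw [measureReal_def, hS, Measure.infinitePi_pi _ fun _ _ => measurableSet_Ico]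
    simp [measureReal_def]
  have hint : ∀ n : Lattice d, Integrable (fun ω : Lattice d → ℝ =>
      ‖spectralProjection (hamiltonian α lam ω) E (delta n)‖ ^ 2) (productMeasure d P₀) := fun n =>
    integrable_norm_spectralProjection_sq P₀ α hlam.ne' E (delta n)
  have h1 : ∫ ω, S.indicator (fun _ => (1 / 2 : ℝ)) ω ∂productMeasure d P₀ ≤
      ∫ ω, ∑ n ∈ B, ‖spectralProjection (hamiltonian α lam ω) E (delta n)‖ ^ 2
        ∂productMeasure d P₀ := by
    refine integral_mono_ae ((integrable_const _).indicator hSm)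
      (integrable_finsetSum _ fun n _ => hint n) ?_
    filter_upwards [ae_nonneg_productMeasure P₀ d hP₀] with ω hω
    by_cases hωS : ω ∈ S
    · rw [Set.indicator_of_mem hωS]
      exact half_le_sum_norm_spectralProjection_sq hα₀ hα₁ hd hlam hω hM
        (fun n hn => (hωS n hn).2.le) hE hME
    · rw [Set.indicator_of_notMem hωS]
      exact Finset.sum_nonneg fun _ _ => sq_nonneg _
  rw [integral_indicator_const _ hSm, hSP, integral_finsetSum _ fun n _ => hint n] at h1
  simp only [integral_norm_spectralProjection_sq P₀ α hlam.ne' E, Finset.sum_const, nsmul_eq_mul,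
    smul_eq_mul] at h1
  rw [div_le_iff₀ (by positivity)]
  linarith

end LowerBound

/-! ### The single-site measure -/

section SingleSiteMeasure

variable {P₀ : Measure ℝ}

theorem measure_Iio_zero_of_isGLB (h : IsGLB P₀.support 0) : P₀ (Set.Iio 0) = 0 := by
  refine measure_mono_null (show Set.Iio 0 ⊆ P₀.supportᶜ from fun x hx hxs => ?_)
    P₀.measure_compl_support
  exact absurd (h.1 hxs) (not_le.mpr hx)

variable [IsProbabilityMeasure P₀]

theorem measureReal_Ico_pos_of_isGLB (h : IsGLB P₀.support 0) {η : ℝ} (hη : 0 < η) :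
    0 < P₀.real (Set.Ico 0 η) := by
  have hmem : (0 : ℝ) ∈ P₀.support :=
    h.mem_of_isClosed (Measure.nonempty_support (IsProbabilityMeasure.ne_zero P₀))
      Measure.isClosed_support
  have hpos : 0 < P₀ (Set.Ioo (-η) η) :=
    Measure.mem_support_iff_forall _ |>.mp hmem _ (Ioo_mem_nhds (by linarith) hη)
  have hsub : Set.Ioo (-η) η ⊆ Set.Iio 0 ∪ Set.Ico 0 η := by
    intro x hx
    rcases lt_or_ge x 0 with h0 | h0
    · exact Or.inl h0
    · exact Or.inr ⟨h0, hx.2⟩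
  have h2 := (measure_mono hsub).trans (measure_union_le (μ := P₀) _ _)
  rw [measure_Iio_zero_of_isGLB h, zero_add] at h2
  exact ENNReal.toReal_pos (hpos.trans_le h2).ne' (measure_ne_top _ _)

theorem exists_measure_Ici_pos (h : P₀ (Set.Iio 0) = 0) (hne : P₀ ≠ Measure.dirac 0) :
    ∃ c > 0, 0 < P₀ (Set.Ici c) := by
  by_contra! hcon
  apply hne
  have hIoi : P₀ (Set.Ioi 0) = 0 := by
    refine measure_mono_null (t := ⋃ n : ℕ, Set.Ici (1 / ((n : ℝ) + 1))) (fun x hx => ?_) ?_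
    · obtain ⟨n, hn⟩ := exists_nat_one_div_lt (Set.mem_Ioi.mp hx)
      exact Set.mem_iUnion.mpr ⟨n, hn.le⟩
    · rw [measure_iUnion_null_iff]
      exact fun n => le_antisymm (hcon _ Nat.one_div_pos_of_nat) zero_le
  have hcompl : P₀ {0}ᶜ = 0 := by
    refine measure_mono_null (t := Set.Iio 0 ∪ Set.Ioi 0) (fun x hx => ?_)
      (measure_union_null h hIoi)
    exact lt_or_gt_of_ne hx
  ext s hs
  rw [Measure.dirac_apply' _ hs]
  by_cases h0 : (0 : ℝ) ∈ s
  · rw [Set.indicator_of_mem h0, Pi.one_apply, ← prob_compl_eq_zero_iff hs]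
    refine measure_mono_null (show sᶜ ⊆ {0}ᶜ from fun x hx hx0 => hx ?_) hcompl
    rwa [Set.mem_singleton_iff.mp hx0]
  · rw [Set.indicator_of_notMem h0]
    refine measure_mono_null (show s ⊆ {0}ᶜ from fun x hx hx0 => h0 ?_) hcompl
    rwa [Set.mem_singleton_iff.mp hx0] at hx

end SingleSiteMeasure

/-! ### Double logarithmic asymptotics -/

section Asymptotics

theorem tendsto_neg_log_nhdsGT_zero : Tendsto (fun E : ℝ => -Real.log E) (𝓝[>] 0) atTop :=
  tendsto_neg_atBot_atTop.comp Real.tendsto_log_nhdsGT_zero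

theorem eventually_log_abs_log_div_log_le {N : ℝ → ℝ} {k γ : ℝ} (hk : 0 < k)
    (hN : ∀ᶠ E in 𝓝[>] 0, Real.log (N E) ≤ -(k * E ^ (-γ))) :
    ∀ᶠ E in 𝓝[>] 0, Real.log |Real.log (N E)| / Real.log E ≤ -γ - Real.log k / -Real.log E := by
  filter_upwards [hN, self_mem_nhdsWithin, tendsto_neg_log_nhdsGT_zero.eventually_gt_atTop 0]
    with E h hE hl
  have hE0 : (0 : ℝ) < E := hE
  have hp : 0 < k * E ^ (-γ) := by positivity
  have h1 : Real.log (k * E ^ (-γ)) ≤ Real.log |Real.log (N E)| := by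
    refine Real.log_le_log hp ?_
    rw [abs_of_nonpos (by linarith)]
    linarith
  rw [Real.log_mul hk.ne' (by positivity), Real.log_rpow hE0] at h1
  have hl0 : Real.log E ≠ 0 := (neg_pos.mp hl).ne
  have h2 : Real.log |Real.log (N E)| / Real.log E =
      -(Real.log |Real.log (N E)| / -Real.log E) := by
    rw [div_neg, neg_neg]
  have h3 : -γ - Real.log k / -Real.log E = -((Real.log k + -γ * Real.log E) / -Real.log E) := by
    field_simp
    ring
  rw [h2, h3]
  exact neg_le_neg (div_le_div_of_nonneg_right h1 hl.le)

theorem eventually_le_log_abs_log_div_log {N : ℝ → ℝ} {k k' γ : ℝ} (hk : 0 < k) (hk' : 0 < k')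
    (hN : ∀ᶠ E in 𝓝[>] 0, Real.log (N E) ≤ -(k * E ^ (-γ)))
    (hN' : ∀ᶠ E in 𝓝[>] 0, -(k' * E ^ (-γ) * -Real.log E) ≤ Real.log (N E)) :
    ∀ᶠ E in 𝓝[>] 0, -γ - (Real.log k' / -Real.log E + Real.log (-Real.log E) / -Real.log E) ≤
      Real.log |Real.log (N E)| / Real.log E := by
  filter_upwards [hN, hN', self_mem_nhdsWithin, tendsto_neg_log_nhdsGT_zero.eventually_gt_atTop 0]
    with E h h' hE hl
  have hE0 : (0 : ℝ) < E := hE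
  have hp : 0 < k * E ^ (-γ) := by positivity
  have h1 : Real.log |Real.log (N E)| ≤ Real.log (k' * E ^ (-γ) * -Real.log E) := by
    refine Real.log_le_log (abs_pos.mpr (by linarith)) ?_
    rw [abs_of_nonpos (by linarith)]
    linarith
  rw [Real.log_mul (by positivity) hl.ne', Real.log_mul hk'.ne' (by positivity),
    Real.log_rpow hE0] at h1
  have hl0 : Real.log E ≠ 0 := (neg_pos.mp hl).ne
  have h2 : Real.log |Real.log (N E)| / Real.log E =
      -(Real.log |Real.log (N E)| / -Real.log E) := by
    rw [div_neg, neg_neg]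
  have h3 : -γ - (Real.log k' / -Real.log E + Real.log (-Real.log E) / -Real.log E) =
      -((Real.log k' + -γ * Real.log E + Real.log (-Real.log E)) / -Real.log E) := by
    generalize Real.log (-Real.log E) = w
    field_simp
    ring
  rw [h2, h3]
  exact neg_le_neg (div_le_div_of_nonneg_right h1 hl.le)

theorem tendsto_sub_div_neg_log (γ a : ℝ) :
    Tendsto (fun E : ℝ => -γ - a / -Real.log E) (𝓝[>] 0) (𝓝 (-γ)) := by
  simpa using (tendsto_const_nhds (x := -γ)).sub
    (tendsto_const_nhds.div_atTop tendsto_neg_log_nhdsGT_zero)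

theorem tendsto_sub_add_div_neg_log (γ a : ℝ) :
    Tendsto (fun E : ℝ => -γ - (a / -Real.log E + Real.log (-Real.log E) / -Real.log E))
      (𝓝[>] 0) (𝓝 (-γ)) := by
  have h1 : Tendsto (fun x : ℝ => Real.log x / x) atTop (𝓝 0) :=
    Real.isLittleO_log_id_atTop.tendsto_div_nhds_zero
  have h2 := h1.comp tendsto_neg_log_nhdsGT_zero
  have h3 : Tendsto (fun E : ℝ => a / -Real.log E) (𝓝[>] 0) (𝓝 0) :=
    tendsto_const_nhds.div_atTop tendsto_neg_log_nhdsGT_zero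
  simpa using (tendsto_const_nhds (x := -γ)).sub (h3.add h2)

end Asymptotics

/-! ### Lifshitz tails -/

section LifshitzTails

variable {d : ℕ} {α lam : ℝ} {P₀ : Measure ℝ} [IsProbabilityMeasure P₀]

/-- The size `M` from which on the bound `(a / M ^ 2) ^ α` on the kinetic energy of the pyramid,
with `a = d * 2 ^ d`, is at most `E / 4`. -/
theorem div_sq_rpow_le {a E M : ℝ} (ha : 0 < a) (hE : 0 < E) (hα : 0 < α)
    (hM : a ^ (1 / 2 : ℝ) * (4 / E) ^ (1 / (2 * α)) ≤ M) : (a / M ^ 2) ^ α ≤ E / 4 := by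
  have hx : 0 < a ^ (1 / 2 : ℝ) * (4 / E) ^ (1 / (2 * α)) := by positivity
  have hx2 : (a ^ (1 / 2 : ℝ) * (4 / E) ^ (1 / (2 * α))) ^ 2 = a * (4 / E) ^ (1 / α) := by
    rw [mul_pow, ← Real.rpow_natCast, ← Real.rpow_natCast, ← Real.rpow_mul ha.le,
      ← Real.rpow_mul (by positivity)]
    norm_num
    left
    congr 1
    field_simp
  have h1 : a / M ^ 2 ≤ (E / 4) ^ (1 / α) := by
    calc a / M ^ 2 ≤ a / (a ^ (1 / 2 : ℝ) * (4 / E) ^ (1 / (2 * α))) ^ 2 := by gcongr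
      _ = (E / 4) ^ (1 / α) := by
        rw [hx2, div_mul_cancel_left₀ ha.ne', ← Real.inv_rpow (by positivity), inv_div]
  calc (a / M ^ 2) ^ α ≤ ((E / 4) ^ (1 / α)) ^ α := by gcongr
    _ = E / 4 := by
      rw [← Real.rpow_mul (by positivity), one_div_mul_cancel hα.ne', Real.rpow_one]

theorem le_ids_of_ceil (hP₀ : P₀ (Set.Iio 0) = 0) (hα₀ : 0 < α) (hα₁ : α ≤ 1) (hd : 0 < d)
    (hlam : 0 < lam) {E : ℝ} (hE : 0 < E) {M : ℕ}
    (hM : ((d : ℝ) * 2 ^ d) ^ (1 / 2 : ℝ) * (4 / E) ^ (1 / (2 * α)) ≤ M) :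
    P₀.real (Set.Ico 0 (E / (4 * lam))) ^ (box d (2 * M)).card / (2 * (box d (2 * M)).card) ≤
      ids d α lam P₀ E := by
  have ha : (0 : ℝ) < d * 2 ^ d := by positivity
  have hx : 0 < ((d : ℝ) * 2 ^ d) ^ (1 / 2 : ℝ) * (4 / E) ^ (1 / (2 * α)) := by positivity
  have hM0 : 0 < M := by exact_mod_cast hx.trans_le hM
  refine le_ids_of_le P₀ hP₀ hα₀ hα₁ hd hlam hM0 hE ?_
  have h1 := div_sq_rpow_le ha hE hα₀ hM
  have h2 : lam * (E / (4 * lam)) = E / 4 := by field_simp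
  linarith

theorem ids_pos (h : IsGLB P₀.support 0) (hα₀ : 0 < α) (hα₁ : α ≤ 1) (hd : 0 < d)
    (hlam : 0 < lam) {E : ℝ} (hE : 0 < E) : 0 < ids d α lam P₀ E := by
  refine lt_of_lt_of_le ?_ (le_ids_of_ceil (measure_Iio_zero_of_isGLB h) hα₀ hα₁ hd hlam hE
    (Nat.le_ceil _))
  have h1 := measureReal_Ico_pos_of_isGLB h (η := E / (4 * lam)) (by positivity)
  have h2 : ∀ L : ℕ, (0 : ℝ) < (box d L).card := fun L => by rw [card_box]; positivity
  exact div_pos (pow_pos h1 _) (mul_pos two_pos (h2 _))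

/-- The Lifshitz upper bound, with neighbourhoods of size `L` about `(ρ / E) ^ (1 / (2 α))`. -/
theorem exists_log_ids_le (h : IsGLB P₀.support 0) (hne : P₀ ≠ Measure.dirac 0) (hα₀ : 0 < α)
    (hα₁ : α ≤ 1) (hd : 0 < d) (hlam : 0 < lam) : ∃ k > 0, ∀ᶠ E in 𝓝[>] (0 : ℝ),
      Real.log (ids d α lam P₀ E) ≤ -(k * E ^ (-((d : ℝ) / (2 * α)))) := by
  have hP₀ := measure_Iio_zero_of_isGLB h
  obtain ⟨c, hc, hPc⟩ := exists_measure_Ici_pos hP₀ hne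
  obtain ⟨θ, hθ, hchern⟩ := exists_measure_countLarge_le P₀ hPc
  set γ : ℝ := (d : ℝ) / (2 * α) with hγ
  have hγ0 : 0 < γ := by positivity
  set K : ℝ := 2 * 4 ^ (1 - α) * (d : ℝ) ^ α + 2 / (c * lam) with hK
  have hK0 : 0 < K := by positivity
  set ρ : ℝ := θ / (2 * K) with hρ
  have hρ0 : 0 < ρ := by positivity
  refine ⟨θ * ρ ^ γ / 2, by positivity, ?_⟩
  have hlarge := (tendsto_rpow_neg_nhdsGT_zero (neg_lt_zero.mpr hγ0)).eventually_ge_atTop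
    (Real.log 2 / (θ * ρ ^ γ / 2))
  filter_upwards [hlarge, self_mem_nhdsWithin, Ioc_mem_nhdsGT hρ0] with E hEl hE hEρ
  have hE0 : (0 : ℝ) < E := hE
  have h1 : 1 ≤ ρ / E := (one_le_div hE0).mpr hEρ.2
  set x : ℝ := (ρ / E) ^ (1 / (2 * α)) with hx
  have hx1 : 1 ≤ x := Real.one_le_rpow h1 (by positivity)
  set L : ℕ := ⌊x⌋₊ with hL
  have hL0 : 0 < L := Nat.floor_pos.mpr hx1
  have hLx : (L : ℝ) ≤ x := Nat.floor_le (by linarith)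
  have hxL : x < L + 1 := Nat.lt_floor_add_one x
  have hLE : K * ((L : ℝ) ^ 2) ^ α * E ≤ θ / 2 := by
    have h2 : ((L : ℝ) ^ 2) ^ α ≤ ρ / E := by
      calc ((L : ℝ) ^ 2) ^ α ≤ (x ^ 2) ^ α := by gcongr
        _ = ρ / E := by
          rw [hx, ← Real.rpow_natCast, ← Real.rpow_mul (by positivity),
            ← Real.rpow_mul (by positivity)]
          have : 1 / (2 * α) * (((2 : ℕ) : ℝ) * α) = 1 := by
            push_cast
            field_simp
          rw [this, Real.rpow_one]
    calc K * ((L : ℝ) ^ 2) ^ α * E ≤ K * (ρ / E) * E := by gcongr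
      _ = θ / 2 := by rw [hρ]; field_simp
  have h3 := ids_le_of_mul_le P₀ hP₀ hd hα₀ hα₁ hlam hc hθ hL0 hLE
  have h4 := h3.trans (mul_le_mul_of_nonneg_left (hchern d L) zero_le_two)
  -- `Real.log 0 = 0`, so positivity of the integrated density of states matters here.
  have h5 := Real.log_le_log (ids_pos h hα₀ hα₁ hd hlam hE0) h4
  rw [Real.log_mul two_ne_zero (Real.exp_pos _).ne', Real.log_exp] at h5
  have h6 : ρ ^ γ * E ^ (-γ) ≤ (box d L).card := by
    rw [card_box]
    push_cast
    calc ρ ^ γ * E ^ (-γ) = x ^ d := by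
          rw [hx, ← Real.rpow_natCast, ← Real.rpow_mul (by positivity), Real.rpow_neg hE0.le,
            ← div_eq_mul_inv, ← Real.div_rpow hρ0.le hE0.le]
          congr 1
          rw [hγ]
          ring
      _ ≤ (2 * (L : ℝ) + 1) ^ d := by
          gcongr
          linarith [(Nat.cast_nonneg L : (0 : ℝ) ≤ L)]
  have h7 := mul_le_mul_of_nonneg_left h6 hθ.le
  have h8 : Real.log 2 ≤ θ * ρ ^ γ / 2 * E ^ (-γ) := by
    rwa [div_le_iff₀' (by positivity)] at hEl
  nlinarith

/-- The Lifshitz lower bound up to a logarithm, with boxes of size `M` about `E ^ (-1 / (2 α))` on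
which the potential is at most `E / (4 * lam)`. -/
theorem exists_le_log_ids (h : IsGLB P₀.support 0) (hα₀ : 0 < α)
    (hα₁ : α ≤ 1) (hd : 0 < d) (hlam : 0 < lam) {C κ : ℝ} (hC : 0 < C) (hκ : 0 < κ)
    (hP : ∀ᶠ ε in 𝓝[>] (0 : ℝ), C * ε ^ κ ≤ P₀.real (Set.Ico 0 ε)) :
    ∃ k > 0, ∀ᶠ E in 𝓝[>] (0 : ℝ),
      -(k * E ^ (-((d : ℝ) / (2 * α))) * -Real.log E) ≤ Real.log (ids d α lam P₀ E) := by
  set γ : ℝ := (d : ℝ) / (2 * α) with hγ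
  set b : ℝ := ((d : ℝ) * 2 ^ d) ^ (1 / 2 : ℝ) * 4 ^ (1 / (2 * α)) with hb
  have hb0 : 0 < b := by positivity
  have hs0 : 0 < 1 / (2 * α) := by positivity
  refine ⟨(10 * b) ^ d * (κ + 1), by positivity, ?_⟩
  have hscale : Tendsto (fun E : ℝ => E / (4 * lam)) (𝓝[>] 0) (𝓝[>] 0) := by
    refine tendsto_nhdsWithin_iff.mpr ⟨?_, ?_⟩
    · have : Tendsto (fun E : ℝ => E / (4 * lam)) (𝓝 0) (𝓝 (0 / (4 * lam))) :=
        tendsto_id.div_const _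
      rw [zero_div] at this
      exact this.mono_left nhdsWithin_le_nhds
    · filter_upwards [self_mem_nhdsWithin] with E hE
      have hE0 : (0 : ℝ) < E := hE
      exact Set.mem_Ioi.mpr (by positivity)
  filter_upwards [hscale.eventually hP, self_mem_nhdsWithin,
    tendsto_neg_log_nhdsGT_zero.eventually_ge_atTop 0,
    tendsto_neg_log_nhdsGT_zero.eventually_ge_atTop (2 - Real.log C + κ * Real.log (4 * lam)),
    (tendsto_rpow_neg_nhdsGT_zero (neg_lt_zero.mpr hs0)).eventually_ge_atTop (1 / b)]
    with E hPE hE hneg hlog hbE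
  have hE0 : (0 : ℝ) < E := hE
  set x : ℝ := b * E ^ (-(1 / (2 * α))) with hx
  have hx1 : 1 ≤ x := by
    rw [div_le_iff₀' hb0] at hbE
    exact hbE
  have hxeq : ((d : ℝ) * 2 ^ d) ^ (1 / 2 : ℝ) * (4 / E) ^ (1 / (2 * α)) = x := by
    rw [hx, hb, Real.div_rpow (by norm_num) hE0.le, Real.rpow_neg hE0.le, mul_assoc,
      div_eq_mul_inv (4 ^ (1 / (2 * α)) : ℝ)]
  set M : ℕ := ⌈x⌉₊ with hM
  have hMx : (M : ℝ) < x + 1 := Nat.ceil_lt_add_one (by linarith)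
  have h1 := le_ids_of_ceil (measure_Iio_zero_of_isGLB h) hα₀ hα₁ hd hlam hE0
    (M := M) (by rw [hxeq]; exact Nat.le_ceil x)
  set p : ℝ := P₀.real (Set.Ico 0 (E / (4 * lam))) with hp
  set B : ℝ := ((box d (2 * M)).card : ℝ) with hB
  have hB0 : 0 < B := by rw [hB, card_box]; positivity
  have hBle : B ≤ (10 * b) ^ d * E ^ (-γ) := by
    rw [hB, card_box]
    push_cast
    calc (2 * (2 * (M : ℝ)) + 1) ^ d ≤ (10 * x) ^ d := by
          gcongr
          linarith
      _ = (10 * b) ^ d * E ^ (-γ) := by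
          rw [hx, ← mul_assoc, mul_pow, ← Real.rpow_natCast (E ^ _), ← Real.rpow_mul hE0.le]
          congr 2
          rw [hγ]
          ring
  have hp1 : 0 < C * (E / (4 * lam)) ^ κ := by positivity
  have hp0 : 0 < p := hp1.trans_le hPE
  have hlogp : Real.log C + κ * (Real.log E - Real.log (4 * lam)) ≤ Real.log p := by
    have := Real.log_le_log hp1 hPE
    rwa [Real.log_mul hC.ne' (by positivity), Real.log_rpow (by positivity),
      Real.log_div hE0.ne' (by positivity)] at this
  have h2 := Real.log_le_log (by positivity) h1
  rw [Real.log_div (by positivity) (by positivity), Real.log_pow, ← hB] at h2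
  have h3 : Real.log (2 * B) ≤ 2 * B - 1 := Real.log_le_sub_one_of_pos (by positivity)
  have hlogE : 0 ≤ κ * -Real.log E + -Real.log E - (2 - Real.log p) := by linarith
  have h4 : B * (2 - Real.log p) ≤ B * ((κ + 1) * -Real.log E) :=
    mul_le_mul_of_nonneg_left (by linarith) hB0.le
  have h5 : B * ((κ + 1) * -Real.log E) ≤ (10 * b) ^ d * E ^ (-γ) * ((κ + 1) * -Real.log E) :=
    mul_le_mul_of_nonneg_right hBle (by positivity)
  nlinarith

end LifshitzTails

end FractionalAnderson

end

theorem theorem2p4 (d : ℕ) (hd : 0 < d) (α : ℝ) (hα₀ : 0 < α) (hα₁ : α ≤ 1)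
    (lam : ℝ) (hlam : 0 < lam)
    (P₀ : Measure ℝ) [IsProbabilityMeasure P₀]
    (hP₀_nontrivial : ∀ c : ℝ, P₀ ≠ Measure.dirac c)
    (hP₀_support : IsGLB P₀.support 0) :
    limsup (fun E : ℝ =>
        ((Real.log |Real.log (FractionalAnderson.ids d α lam P₀ E)| / Real.log E : ℝ) : EReal))
        (𝓝[>] (0 : ℝ)) ≤ ((-((d : ℝ) / (2 * α)) : ℝ) : EReal) ∧
      ((∃ C > (0 : ℝ), ∃ κ > (0 : ℝ), ∀ᶠ ε in 𝓝[>] (0 : ℝ),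
          C * ε ^ κ ≤ P₀.real (Set.Ico 0 ε)) →
        Tendsto (fun E : ℝ =>
            Real.log |Real.log (FractionalAnderson.ids d α lam P₀ E)| / Real.log E)
          (𝓝[>] (0 : ℝ)) (𝓝 (-((d : ℝ) / (2 * α))))) := by
  obtain ⟨k, hk, hupper⟩ := FractionalAnderson.exists_log_ids_le (d := d) (lam := lam) hP₀_support
    (hP₀_nontrivial 0) hα₀ hα₁ hd hlam
  have hle := FractionalAnderson.eventually_log_abs_log_div_log_le hk hupper
  have hlim := FractionalAnderson.tendsto_sub_div_neg_log ((d : ℝ) / (2 * α)) (Real.log k)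
  refine ⟨?_, ?_⟩
  · rw [← ((continuous_coe_real_ereal.tendsto _).comp hlim).limsup_eq]
    exact limsup_le_limsup (hle.mono fun E hE => EReal.coe_le_coe_iff.mpr hE)
  · rintro ⟨C, hC, κ, hκ, hP⟩
    obtain ⟨k', hk', hlower⟩ := FractionalAnderson.exists_le_log_ids (d := d) (lam := lam)
      hP₀_support hα₀ hα₁ hd hlam hC hκ hP
    exact tendsto_of_tendsto_of_tendsto_of_le_of_le'
      (FractionalAnderson.tendsto_sub_add_div_neg_log _ (Real.log k')) hlim
      (FractionalAnderson.eventually_le_log_abs_log_div_log hk hk' hupper hlower) hle
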